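/- Let $\Omega\subset\mathbb{R}^3$ be a bounded open set and let $\sigma$ assign to every point of $\Omega$ a real symmetric positive definite $3\times 3$ matrix. Let $x_0,M\in\mathbb{R}^3$, and let $\Omega^\infty\subset\Omega$ (the patch) contain a neighbourhood of $x_0$. Suppose $\sigma$ is constant, with value $\sigma^\infty$, on a neighbourhood of $x_0$. The boundary of $\Omega^\infty$ is assumed to be piecewise Lipschitz: $\partial\Omega^\infty$ has finite surface area and, outside a closed set of surface area zero, it is locally a Lipschitz graph with $\Omega^\infty$ on exactly one side. Let $\widetilde\Omega\subset\Omega\setminus\Omega^\infty$ be a measurable set (the transition region) with $\partial\Omega^\infty\subset\partial\Omega\cup\partial\widetilde\Omega$, and let $\chi\in H^1(\Omega)$ be continuous on $\Omega$ with $\chi=1$ on $\Omega^\infty$ and $\chi=0$ on $\Omega\setminus(\Omega^\infty\cup\widetilde\Omega)$. Let $$u^\infty(x)=\frac{1}{4\pi\sqrt{\det\sigma^\infty}}\,\frac{\langle M,(\sigma^\infty)^{-1}(x-x_0)\rangle}{\|(\sigma^\infty)^{-1/2}(x-x_0)\|^3}$$ be the potential of the dipole with moment $M$ at $x_0$ in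 the unbounded homogeneous conductor with conductivity $\sigma^\infty$, and let $\eta$ be the unit outer normal of $\Omega^\infty$. For $v\in H^1(\Omega)$ put $\sigma^c=\sigma-\sigma^\infty$ and $$l(v)=-\int_{\widetilde\Omega}\langle\sigma\nabla(\chi u^\infty),\nabla v\rangle\,dV-\int_{\partial\Omega^\infty}\langle\sigma^\infty\nabla u^\infty,\eta\rangle\,v\,dS-\int_{\Omega^\infty}\langle\sigma^c\nabla u^\infty,\nabla v\rangle\,dV,$$ where in the surface integral $v$ denotes the trace of $v$ taken from inside $\Omega^\infty$. Then the constant functions belong to $H^1(\Omega)$ and $l$ vanishes on them: $l(v)=0$ for every $v$ that is almost everywhere equal to a constant on $\Omega$. Moreover, $\langle\sigma^\infty\nabla u^\infty,\eta\rangle$ is integrable over $\partial\Omega^\infty$ with respect to surface measure, and $$\int_{\partial\Omega^\infty}\langle\sigma^\infty\nabla u^\infty,\eta\rangle\,dS=0.$$ -/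

import Mathlib

open MeasureTheory Set Filter Topology
open scoped ContDiff RealInnerProductSpace NNReal Gradient

namespace LocalizedSubtraction

/-- Three-dimensional Euclidean space. -/
abbrev E3 : Type := EuclideanSpace ℝ (Fin 3)

/-- Real `3 × 3` matrices (conductivity tensors). -/
abbrev Mat3 : Type := Matrix (Fin 3) (Fin 3) ℝ

/-- The matrix-vector product `A x` in Euclidean space. -/
noncomputable def app (A : Mat3) (x : E3) : E3 :=
  Matrix.toEuclideanCLM (n := Fin 3) (𝕜 := ℝ) A x

/-! ### Weak gradients and the Sobolev space `H¹` -/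

/-- `g` is the weak gradient of `v` on the open set `Ω`. -/
def HasWeakGradient (Ω : Set E3) (v : E3 → ℝ) (g : E3 → E3) : Prop :=
  LocallyIntegrableOn v Ω ∧ LocallyIntegrableOn g Ω ∧
    ∀ φ : E3 → ℝ, ContDiff ℝ ∞ φ → HasCompactSupport φ → tsupport φ ⊆ Ω →
      ∫ x in Ω, v x • ∇ φ x = - ∫ x in Ω, φ x • g x

open Classical in
/-- The weak gradient of `v` on the open set `Ω`, determined almost everywhere on `Ω`
(zero if there is none). -/
noncomputable def weakGradient (Ω : Set E3) (v : E3 → ℝ) : E3 → E3 :=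
  if h : ∃ g, HasWeakGradient Ω v g then h.choose else 0

/-- Membership in the Sobolev space `H¹(Ω)`. -/
def MemH1 (Ω : Set E3) (v : E3 → ℝ) : Prop :=
  MemLp v 2 (volume.restrict Ω) ∧
    ∃ g, HasWeakGradient Ω v g ∧ MemLp g 2 (volume.restrict Ω)

/-- The trace of `v` on the boundary of `A`, taken from inside `A`: at a boundary point `y` it is
the limit of the mean values of `v` over `B(y, r) ∩ A` as `r → 0`.  For `v` in `H¹` and `A` with a
Lipschitz boundary this is the usual Sobolev trace, almost everywhere with respect to surface
measure. -/
noncomputable def trace (A : Set E3) (v : E3 → ℝ) (y : E3) : ℝ :=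
  limUnder (𝓝[>] (0 : ℝ)) (fun r => ⨍ x in Metric.ball y r ∩ A, v x)

/-! ### Boundaries, outer normals and fluxes -/

/-- Near the boundary point `p`, the set `A` lies on one side of a Lipschitz graph: after a linear
isometry `T : ℝ³ → ℝ² × ℝ` it is the set of points below the graph of a Lipschitz function `g`.
Which points of the graph itself belong to `A` is left open, so that open as well as
closed regions are covered. -/
def IsLipschitzBoundaryPoint (A : Set E3) (p : E3) : Prop :=
  ∃ (T : E3 ≃ₗᵢ[ℝ] WithLp 2 (EuclideanSpace ℝ (Fin 2) × ℝ)) (K : ℝ≥0)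
    (g : EuclideanSpace ℝ (Fin 2) → ℝ),
    LipschitzWith K g ∧
      ∀ᶠ x in 𝓝 p, ((T x).snd < g (T x).fst → x ∈ A) ∧ (g (T x).fst < (T x).snd → x ∉ A)

/-- The boundary of `A` has finite surface area and is locally a Lipschitz graph with `A` on one
side, except on a closed exceptional set of surface area zero.  This covers `C¹` regions, Lipschitz
regions, and all finite unions of closed nondegenerate polyhedral (for instance tetrahedral or
hexahedral) elements. -/
def HasPiecewiseLipschitzBoundary (A : Set E3) : Prop :=
  μHE[2] (frontier A) < ⊤ ∧
    ∃ N : Set E3, IsClosed N ∧ μHE[2] N = 0 ∧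
      ∀ p ∈ frontier A \ N, IsLipschitzBoundaryPoint A p

/-- `n` is the outer unit normal of `A` at `y`: near `y`, and off arbitrarily narrow neighbourhoods
of the plane through `y` orthogonal to `n`, the set `A` is the half space that `n` points out of. -/
def IsOuterUnitNormal (A : Set E3) (y n : E3) : Prop :=
  ‖n‖ = 1 ∧ ∀ ε > 0, ∀ᶠ x in 𝓝 y,
    (⟪x - y, n⟫ < -ε * ‖x - y‖ → x ∈ A) ∧ (ε * ‖x - y‖ < ⟪x - y, n⟫ → x ∉ A)

/-- There is at most one outer unit normal at a point. -/
theorem IsOuterUnitNormal.unique {A : Set E3} {y n m : E3}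
    (hn : IsOuterUnitNormal A y n) (hm : IsOuterUnitNormal A y m) : n = m := by
  by_contra hne
  have h1 : ⟪n, m⟫ < 1 := by
    rcases lt_or_eq_of_le ((real_inner_le_norm n m).trans_eq (by rw [hn.1, hm.1, one_mul])) with h | h
    · exact h
    · exact absurd ((inner_eq_one_iff_of_norm_eq_one (𝕜 := ℝ) hn.1 hm.1).1 h) hne
  set w : E3 := m - n with hw
  have hnn : ⟪n, n⟫ = 1 := by rw [real_inner_self_eq_norm_sq, hn.1]; norm_num
  have hmm : ⟪m, m⟫ = 1 := by rw [real_inner_self_eq_norm_sq, hm.1]; norm_num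
  have hwn : ⟪w, n⟫ = -(1 - ⟪n, m⟫) := by
    rw [hw, inner_sub_left, hnn, real_inner_comm]; ring
  have hwm : ⟪w, m⟫ = 1 - ⟪n, m⟫ := by rw [hw, inner_sub_left, hmm]
  have hw0 : 0 < ‖w‖ := norm_pos_iff.2 (sub_ne_zero.2 (Ne.symm hne))
  set ε : ℝ := (1 - ⟪n, m⟫) / (2 * ‖w‖) with hε
  have hε0 : 0 < ε := div_pos (by linarith) (by positivity)
  have hεw : ε * ‖w‖ = (1 - ⟪n, m⟫) / 2 := by rw [hε]; field_simp
  have hlim : Tendsto (fun t : ℝ => y + t • w) (𝓝[>] 0) (𝓝 y) := by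
    have : Tendsto (fun t : ℝ => y + t • w) (𝓝 0) (𝓝 (y + (0 : ℝ) • w)) :=
      (Continuous.tendsto (by fun_prop) 0)
    simpa using this.mono_left nhdsWithin_le_nhds
  obtain ⟨t, ⟨ha, hb⟩, ht⟩ :=
    ((hlim.eventually ((hn.2 ε hε0).and (hm.2 ε hε0))).and self_mem_nhdsWithin).exists
  have ht0 : (0 : ℝ) < t := ht
  have hx : y + t • w - y = t • w := by abel
  rw [hx, norm_smul, Real.norm_of_nonneg ht0.le, inner_smul_left] at ha hb
  simp only [conj_trivial, hwn, hwm] at ha hb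
  refine hb.2 ?_ (ha.1 ?_)
  · nlinarith
  · nlinarith

open Classical in
/-- The outer unit normal field of `A` (zero at points without an outer unit normal). -/
noncomputable def outerNormal (A : Set E3) (y : E3) : E3 :=
  if h : ∃ n, IsOuterUnitNormal A y n then h.choose else 0

/-! ### The dipole potential and the right-hand side functional -/

/-- The potential `u^∞` of the dipole with moment `M` at `x₀` in the unbounded homogeneous conductor
with conductivity `S`, i.e. the decaying solution of `div (S ∇u) = div (M δ_{x₀})` on `ℝ³`:
`u(x) = ⟨M, S⁻¹ (x - x₀)⟩ / (4 π √(det S) ‖S^{-1/2} (x - x₀)‖³)`,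
where `‖S^{-1/2} z‖ = √⟨z, S⁻¹ z⟩`. -/
noncomputable def dipolePotential (S : Mat3) (M x₀ : E3) (x : E3) : ℝ :=
  1 / (4 * Real.pi * √S.det) *
    (⟪M, app S⁻¹ (x - x₀)⟫ / √⟪x - x₀, app S⁻¹ (x - x₀)⟫ ^ 3)

/-- The flux density `⟨S ∇u, η⟩` through the boundary of `A`, with `u` the dipole potential in the
homogeneous conductor `S` and `η` the outer unit normal of `A`. -/
noncomputable def fluxDensity (S : Mat3) (M x₀ : E3) (A : Set E3) (y : E3) : ℝ :=
  ⟪app S (∇ (dipolePotential S M x₀) y), outerNormal A y⟫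

/-- The right-hand side functional `l` of the localized subtraction approach on the domain `Ω`, with
patch `P`, transition region `R`, cutoff function `χ`, conductivity `σ`, and conductivity `S` near
the source position `x₀`:
`l(v) = - ∫_R ⟨σ ∇(χ u^∞), ∇v⟩ dV - ∫_{∂P} ⟨S ∇u^∞, η⟩ v dS - ∫_P ⟨(σ - S) ∇u^∞, ∇v⟩ dV`.
Since `u^∞` is singular at `x₀`, which lies outside `R`, the weak gradient of `χ u^∞` is taken on
`Ω \ {x₀}`. -/
noncomputable def rhs (Ω P R : Set E3) (χ : E3 → ℝ) (σ : E3 → Mat3) (S : Mat3) (M x₀ : E3)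
    (v : E3 → ℝ) : ℝ :=
  - (∫ x in R, ⟪app (σ x) (weakGradient (Ω \ {x₀}) (fun z => χ z * dipolePotential S M x₀ z) x),
        weakGradient Ω v x⟫)
    - (∫ y in frontier P, fluxDensity S M x₀ P y * trace P v y ∂μHE[2])
    - ∫ x in P, ⟪app (σ x - S) (∇ (dipolePotential S M x₀) x), weakGradient Ω v x⟫

end LocalizedSubtraction

/-! If `v` equals a constant `c` almost everywhere, its weak gradient vanishes almost everywhere and
both volume integrals drop out. At every Lipschitz boundary point of the patch its trace is `c`.
What remains is `-c` times the flux of the dipole through the patch boundary, so everything reduces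
to the vanishing of that flux.

Up to a constant factor, the flux field is `F(z) = r⁻³ M - 3 ⟨M, Bz⟩ r⁻⁵ z`, with `z = x - x₀`, `B =
S⁻¹` and `r² = ⟨z, Bz⟩`. It is divergence free off the origin (`sum_fderiv_dipoleField`) and even.
Let `β` be a bump function around `x₀`, symmetric about `x₀` and supported inside the patch. Then
`(1 - β) F` is smooth on the whole space and equals `F` on the patch boundary. Its divergence
vanishes outside the patch and, as the divergence of an even field, is odd about `x₀`, so it
integrates to zero. No flux through a small sphere has to be computed. The divergence theorem then
finishes the proof (`integral_inner_dipoleField_outerNormal`).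

The bulk of the work is this divergence theorem for piecewise Lipschitz regions with Hausdorff
surface measure. The area formula identifies surface measure on a Lipschitz graph
(`map_graphChart`). Below a graph, a shear and Fubini give the theorem
(`setIntegral_fderiv_subgraph`), and a partition of unity glues the charts. The exceptional set is
removed by cutoffs (`exists_cutoff`): a compact set of area zero is covered by balls with small `∑
r²`, and a bump of radius `r` has a gradient of `L¹` norm proportional to `r²`. The error from the
cutoffs therefore tends to zero. -/

namespace LocalizedSubtraction

/-! ### The area formula for differentiable antilipschitz maps -/

section AreaFormula

open Metric Module
open scoped ENNReal Pointwise

/-- A map that is approximated by `A` on `s` up to `δ` has its derivatives within `δ` of `A`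
at almost every point of `s`. -/
theorem norm_fderiv_sub_le_of_approximatesLinearOn {E F : Type*} [NormedAddCommGroup E]
    [NormedSpace ℝ E] [FiniteDimensional ℝ E] [NormedAddCommGroup F] [NormedSpace ℝ F]
    [MeasurableSpace E] [BorelSpace E] (μ : Measure E) [μ.IsAddHaarMeasure] {s : Set E}
    {f : E → F} {A : E →L[ℝ] F} {δ : ℝ≥0}
    (hf : ApproximatesLinearOn f A s δ) (hs : MeasurableSet s) (f' : E → E →L[ℝ] F)
    (hf' : ∀ x ∈ s, HasFDerivWithinAt f (f' x) s x) : ∀ᵐ x ∂μ.restrict s, ‖f' x - A‖₊ ≤ δ := by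
  filter_upwards [Besicovitch.ae_tendsto_measure_inter_div μ s, ae_restrict_mem hs]
  intro x hx xs
  apply ContinuousLinearMap.opNorm_le_bound _ δ.2 fun z => ?_
  -- At a density point `x` of `s`, every direction `z` is nearly realised by some `y = x + r • a`
  -- in `s` with `a` close to `z`. Comparing both linear approximations of `f y - f x` bounds `(f' x
  -- - A) a`, hence nearly `(f' x - A) z`.
  suffices H : ∀ ε, 0 < ε → ‖(f' x - A) z‖ ≤ (δ + ε) * (‖z‖ + ε) + ‖f' x - A‖ * ε by
    have :
      Tendsto (fun ε : ℝ => ((δ : ℝ) + ε) * (‖z‖ + ε) + ‖f' x - A‖ * ε) (𝓝[>] 0)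
        (𝓝 ((δ + 0) * (‖z‖ + 0) + ‖f' x - A‖ * 0)) :=
      Tendsto.mono_left (Continuous.tendsto (by fun_prop) 0) nhdsWithin_le_nhds
    simp only [add_zero, mul_zero] at this
    apply le_of_tendsto_of_tendsto tendsto_const_nhds this
    filter_upwards [self_mem_nhdsWithin]
    exact H
  intro ε εpos
  have B₁ : ∀ᶠ r in 𝓝[>] (0 : ℝ), (s ∩ ({x} + r • closedBall z ε)).Nonempty :=
    Measure.eventually_nonempty_inter_smul_of_density_one μ s x hx _ measurableSet_closedBall
      (measure_closedBall_pos μ z εpos).ne'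
  obtain ⟨ρ, ρpos, hρ⟩ :
    ∃ ρ > 0, ball x ρ ∩ s ⊆ {y : E | ‖f y - f x - (f' x) (y - x)‖ ≤ ε * ‖y - x‖} :=
    mem_nhdsWithin_iff.1 ((hf' x xs).isLittleO.def εpos)
  have B₂ : ∀ᶠ r in 𝓝[>] (0 : ℝ), {x} + r • closedBall z ε ⊆ ball x ρ := by
    apply nhdsWithin_le_nhds
    exact eventually_singleton_add_smul_subset isBounded_closedBall (ball_mem_nhds x ρpos)
  obtain ⟨r, ⟨y, ⟨ys, hy⟩⟩, rρ, rpos⟩ :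
    ∃ r : ℝ,
      (s ∩ ({x} + r • closedBall z ε)).Nonempty ∧ {x} + r • closedBall z ε ⊆ ball x ρ ∧ 0 < r :=
    (B₁.and (B₂.and self_mem_nhdsWithin)).exists
  obtain ⟨a, az, ya⟩ : ∃ a, a ∈ closedBall z ε ∧ y = x + r • a := by
    simp only [mem_smul_set, image_add_left, mem_preimage, singleton_add] at hy
    rcases hy with ⟨a, az, ha⟩
    exact ⟨a, az, by simp only [ha, add_neg_cancel_left]⟩
  have norm_a : ‖a‖ ≤ ‖z‖ + ε :=
    calc
      ‖a‖ = ‖z + (a - z)‖ := by simp only [add_sub_cancel]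
      _ ≤ ‖z‖ + ‖a - z‖ := norm_add_le _ _
      _ ≤ ‖z‖ + ε := by grw [mem_closedBall_iff_norm.1 az]
  have I : r * ‖(f' x - A) a‖ ≤ r * (δ + ε) * (‖z‖ + ε) :=
    calc
      r * ‖(f' x - A) a‖ = ‖(f' x - A) (r • a)‖ := by
        simp only [map_smul, norm_smul, Real.norm_eq_abs, abs_of_nonneg rpos.le]
      _ = ‖f y - f x - A (y - x) - (f y - f x - (f' x) (y - x))‖ := by
        simp only [ya, add_sub_cancel_left, sub_sub_sub_cancel_left, FunLike.coe_sub,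
          Pi.sub_apply, map_smul, smul_sub]
      _ ≤ ‖f y - f x - A (y - x)‖ + ‖f y - f x - (f' x) (y - x)‖ := norm_sub_le _ _
      _ ≤ δ * ‖y - x‖ + ε * ‖y - x‖ := (add_le_add (hf _ ys _ xs) (hρ ⟨rρ hy, ys⟩))
      _ = r * (δ + ε) * ‖a‖ := by
        simp only [ya, add_sub_cancel_left, norm_smul, Real.norm_eq_abs, abs_of_nonneg rpos.le]
        ring
      _ ≤ r * (δ + ε) * (‖z‖ + ε) := by gcongr
  calc
    ‖(f' x - A) z‖ = ‖(f' x - A) a + (f' x - A) (z - a)‖ := by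
      congr 1
      simp only [FunLike.coe_sub, map_sub, Pi.sub_apply]
      abel
    _ ≤ ‖(f' x - A) a‖ + ‖(f' x - A) (z - a)‖ := norm_add_le _ _
    _ ≤ (δ + ε) * (‖z‖ + ε) + ‖f' x - A‖ * ‖z - a‖ := by
      apply add_le_add
      · rw [mul_assoc] at I; exact (mul_le_mul_iff_right₀ rpos).1 I
      · apply ContinuousLinearMap.le_opNorm
    _ ≤ (δ + ε) * (‖z‖ + ε) + ‖f' x - A‖ * ε := by
      rw [mem_closedBall_iff_norm'] at az
      gcongr

/-- If `f` stretches distances on `s` by at most `K` times as much as `g` does, then so it does with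
Hausdorff measures. -/
theorem euclideanHausdorffMeasure_image_le_of_dist_le {α X Y : Type*} [MetricSpace X]
    [MeasurableSpace X] [BorelSpace X] [MetricSpace Y] [MeasurableSpace Y] [BorelSpace Y]
    (d : ℕ) {K : ℝ≥0} {s : Set α} {f : α → Y} {g : α → X}
    (h : ∀ x ∈ s, ∀ y ∈ s, dist (f x) (f y) ≤ K * dist (g x) (g y)) :
    μHE[d] (f '' s) ≤ (K : ℝ≥0∞) ^ d * μHE[d] (g '' s) := by
  rcases s.eq_empty_or_nonempty with rfl | ⟨x₀, hx₀⟩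
  · simp
  have : Nonempty α := ⟨x₀⟩
  -- On `s`, points with the same `g` have the same `f`, so `f` factors through `g` by a
  -- `K`-Lipschitz map.
  set F : X → Y := fun z => f (Function.invFunOn g s z)
  have hmem : ∀ x ∈ s, Function.invFunOn g s (g x) ∈ s := fun x hx =>
    Function.invFunOn_mem ⟨x, hx, rfl⟩
  have heq : ∀ x ∈ s, g (Function.invFunOn g s (g x)) = g x := fun x hx =>
    Function.invFunOn_eq ⟨x, hx, rfl⟩
  have hF : ∀ x ∈ s, F (g x) = f x := fun x hx => by
    have := h _ (hmem x hx) x hx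
    rw [heq x hx, dist_self, mul_zero] at this
    exact dist_le_zero.1 this
  have hL : LipschitzOnWith K F (g '' s) := by
    refine LipschitzOnWith.of_dist_le_mul ?_
    rintro _ ⟨x, hx, rfl⟩ _ ⟨y, hy, rfl⟩
    rw [hF x hx, hF y hy]
    exact h x hx y hy
  have himg : f '' s = F '' (g '' s) := by
    rw [image_image]
    exact image_congr fun x hx => (hF x hx).symm
  rw [himg, Measure.euclideanHausdorffMeasure_def, Measure.euclideanHausdorffMeasure_def,
    Measure.smul_apply, Measure.smul_apply, ENNReal.smul_def, ENNReal.smul_def, smul_eq_mul,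
    smul_eq_mul, mul_left_comm]
  gcongr
  simpa using hL.hausdorffMeasure_image_le (d := d) (by positivity)

/-- Near-isometry bounds for a map that is close to an antilipschitz linear map. -/
theorem dist_bounds_of_approximatesLinearOn {U V : Type*} [NormedAddCommGroup U]
    [NormedSpace ℝ U] [NormedAddCommGroup V] [NormedSpace ℝ V] {A : U →L[ℝ] V} {κ δ K : ℝ≥0} {s : Set U} {f : U → V}
    (hK : 1 < K) (hA : ∀ v, ‖v‖ ≤ κ * ‖A v‖) (hδ : (δ : ℝ) * κ ≤ 1 - (K : ℝ)⁻¹)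
    (hf : ApproximatesLinearOn f A s δ) :
    (∀ x ∈ s, ∀ y ∈ s, dist (f x) (f y) ≤ K * dist (A x) (A y)) ∧
      ∀ x ∈ s, ∀ y ∈ s, dist (A x) (A y) ≤ K * dist (f x) (f y) := by
  have hK1 : (1 : ℝ) < K := by exact_mod_cast hK
  have hK0 : (0 : ℝ) < K := by linarith
  -- A relative error of `1 - K⁻¹` serves both directions: the lower factor is exactly `K⁻¹`, and
  -- the upper one is `2 - K⁻¹ ≤ K`.
  have key : ∀ x ∈ s, ∀ y ∈ s, ‖f x - f y - A (x - y)‖ ≤ (1 - (K : ℝ)⁻¹) * ‖A (x - y)‖ := by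
    intro x hx y hy
    calc ‖f x - f y - A (x - y)‖ ≤ δ * ‖x - y‖ := hf x hx y hy
      _ ≤ δ * (κ * ‖A (x - y)‖) := by gcongr; exact hA _
      _ = δ * κ * ‖A (x - y)‖ := by ring
      _ ≤ _ := by gcongr
  constructor
  · intro x hx y hy
    have h1 := key x hx y hy
    have h2 : ‖f x - f y‖ ≤ ‖f x - f y - A (x - y)‖ + ‖A (x - y)‖ := by
      simpa using norm_add_le (f x - f y - A (x - y)) (A (x - y))
    rw [dist_eq_norm, dist_eq_norm, ← map_sub]
    have h3 : 2 - (K : ℝ)⁻¹ ≤ K := by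
      have : (K : ℝ) * (K : ℝ)⁻¹ = 1 := mul_inv_cancel₀ hK0.ne'
      nlinarith [inv_pos.2 hK0, sq_nonneg ((K : ℝ) - 1)]
    nlinarith [norm_nonneg (A (x - y))]
  · intro x hx y hy
    have h1 := key x hx y hy
    have h2 : ‖A (x - y)‖ ≤ ‖f x - f y‖ + ‖f x - f y - A (x - y)‖ := by
      simpa using norm_sub_le (f x - f y) (f x - f y - A (x - y))
    rw [dist_eq_norm, dist_eq_norm, ← map_sub]
    have h3 : (K : ℝ)⁻¹ * ‖A (x - y)‖ ≤ ‖f x - f y‖ := by linarith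
    rwa [inv_mul_le_iff₀ hK0] at h3

variable {U V : Type*} [NormedAddCommGroup U] [InnerProductSpace ℝ U] [FiniteDimensional ℝ U]
  [MeasurableSpace U] [BorelSpace U] [NormedAddCommGroup V] [InnerProductSpace ℝ V]
  [MeasurableSpace V] [BorelSpace V]

/-- The measure of the image under a map close to the linear map `A` is close to that under `A`. -/
theorem euclideanHausdorffMeasure_image_bounds {A : U →L[ℝ] V} {κ δ K : ℝ≥0} {s : Set U}
    {f : U → V} (hK : 1 < K) (hA : ∀ v, ‖v‖ ≤ κ * ‖A v‖) (hδ : (δ : ℝ) * κ ≤ 1 - (K : ℝ)⁻¹)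
    (hf : ApproximatesLinearOn f A s δ) :
    μHE[finrank ℝ U] (f '' s) ≤
        (K : ℝ≥0∞) ^ finrank ℝ U * (ENNReal.ofReal A.toLinearMap.normDet * volume s) ∧
      ENNReal.ofReal A.toLinearMap.normDet * volume s ≤
        (K : ℝ≥0∞) ^ finrank ℝ U * μHE[finrank ℝ U] (f '' s) := by
  obtain ⟨h1, h2⟩ := dist_bounds_of_approximatesLinearOn hK hA hδ hf
  rw [← A.toLinearMap.euclideanHausdorffMeasure_image_eq_normDet_mul_volume s]
  exact ⟨euclideanHausdorffMeasure_image_le_of_dist_le _ h1,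
    euclideanHausdorffMeasure_image_le_of_dist_le _ h2⟩

/-- The volume factors of two nearby linear maps are close to each other. -/
theorem normDet_bounds_of_norm_sub_le {A B : U →L[ℝ] V} {κ δ K : ℝ≥0}
    (hK : 1 < K) (hA : ∀ v, ‖v‖ ≤ κ * ‖A v‖) (hδ : (δ : ℝ) * κ ≤ 1 - (K : ℝ)⁻¹)
    (hB : ‖B - A‖₊ ≤ δ) :
    ENNReal.ofReal B.toLinearMap.normDet ≤
        (K : ℝ≥0∞) ^ finrank ℝ U * ENNReal.ofReal A.toLinearMap.normDet ∧
      ENNReal.ofReal A.toLinearMap.normDet ≤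
        (K : ℝ≥0∞) ^ finrank ℝ U * ENNReal.ofReal B.toLinearMap.normDet := by
  -- The linear map `B` is itself a map close to `A`. The image bounds are applied to it on the unit
  -- ball, whose volume then cancels.
  have happ : ApproximatesLinearOn B A (ball 0 1) δ := by
    intro x _ y _
    rw [← map_sub, ← sub_apply]
    exact (ContinuousLinearMap.le_opNorm _ _).trans (by gcongr; exact_mod_cast hB)
  obtain ⟨h1, h2⟩ := euclideanHausdorffMeasure_image_bounds hK hA hδ happ
  have hB' := B.toLinearMap.euclideanHausdorffMeasure_image_eq_normDet_mul_volume (ball 0 1)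
  rw [ContinuousLinearMap.coe_coe] at hB'
  rw [hB', ← mul_assoc] at h1 h2
  have v0 : volume (ball (0 : U) 1) ≠ 0 := (measure_ball_pos _ _ one_pos).ne'
  have v1 : volume (ball (0 : U) 1) ≠ ⊤ := measure_ball_lt_top.ne
  exact ⟨(ENNReal.mul_le_mul_iff_left v0 v1).1 h1, (ENNReal.mul_le_mul_iff_left v0 v1).1 h2⟩

/-- **Area formula** for antilipschitz maps. -/
theorem euclideanHausdorffMeasure_image_eq_lintegral [FiniteDimensional ℝ V] {f : U → V} {f' : U → U →L[ℝ] V} {κ : ℝ≥0}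
    {s : Set U} (hs : MeasurableSet s) (hf : AntilipschitzWith κ f) (hc : Continuous f)
    (hf' : ∀ x ∈ s, HasFDerivAt f (f' x) x) :
    μHE[finrank ℝ U] (f '' s) = ∫⁻ x in s, ENNReal.ofReal (f' x).toLinearMap.normDet := by
  set d := finrank ℝ U
  have hanti : ∀ x ∈ s, ∀ v, ‖v‖ ≤ κ * ‖f' x v‖ := by
    intro x hx v
    have h1 : Tendsto (fun t : ℝ => κ * ‖t⁻¹ • (f (x + t • v) - f x)‖) (𝓝[≠] 0)
        (𝓝 (κ * ‖f' x v‖)) :=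
      (((hf' x hx).hasLineDerivAt v).tendsto_slope_zero.norm).const_mul _
    refine ge_of_tendsto h1 ?_
    filter_upwards [self_mem_nhdsWithin] with t ht
    have ht' : (0 : ℝ) < |t| := abs_pos.2 ht
    have h2 := hf.le_mul_dist (x + t • v) x
    rw [dist_eq_norm, dist_eq_norm, add_sub_cancel_left, norm_smul, Real.norm_eq_abs] at h2
    rw [norm_smul, norm_inv, Real.norm_eq_abs, mul_left_comm, le_inv_mul_iff₀ ht']
    exact h2
  -- On each piece of a fine partition, `f` and its derivative are both compared with one linear
  -- map. Each comparison costs a factor `K ^ d`, and finally `K → 1`.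
  have main : ∀ K : ℝ≥0, 1 < K →
      μHE[d] (f '' s) ≤ ((K : ℝ≥0∞) ^ d * (K : ℝ≥0∞) ^ d) *
        ∫⁻ x in s, ENNReal.ofReal (f' x).toLinearMap.normDet ∧
      ∫⁻ x in s, ENNReal.ofReal (f' x).toLinearMap.normDet ≤
        ((K : ℝ≥0∞) ^ d * (K : ℝ≥0∞) ^ d) * μHE[d] (f '' s) := by
    intro K hK
    have hK1 : (1 : ℝ) < K := by exact_mod_cast hK
    have hη : 0 < 1 - (K : ℝ)⁻¹ := by
      have := inv_lt_one_of_one_lt₀ hK1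
      linarith
    obtain ⟨δ, hδ0, hδ⟩ : ∃ δ : ℝ≥0, 0 < δ ∧ (δ : ℝ) * κ ≤ 1 - (K : ℝ)⁻¹ := by
      refine ⟨((1 - (K : ℝ)⁻¹) / (κ + 1)).toNNReal, Real.toNNReal_pos.2 (by positivity), ?_⟩
      · rw [Real.coe_toNNReal _ (by positivity)]
        rw [div_mul_eq_mul_div, div_le_iff₀ (by positivity)]
        nlinarith [κ.2]
    obtain ⟨t, A, tdisj, tmeas, tcov, tapp, tA⟩ :=
      exists_partition_approximatesLinearOn_of_hasFDerivWithinAt f s f'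
        (fun x hx => (hf' x hx).hasFDerivWithinAt) (fun _ => δ) (fun _ => hδ0.ne')
    -- The maps `A n` are known to be derivatives at points of `s`, hence antilipschitz, only if `s`
    -- is nonempty.
    rcases s.eq_empty_or_nonempty with rfl | hne
    · simp
    have hA : ∀ n, ∀ v, ‖v‖ ≤ κ * ‖A n v‖ := by
      intro n
      obtain ⟨y, hy, e⟩ := tA hne n
      rw [e]; exact hanti y hy
    have hsn : ∀ n, MeasurableSet (s ∩ t n) := fun n => hs.inter (tmeas n)
    have hdisj : Pairwise (Function.onFun Disjoint fun n => s ∩ t n) := fun i j hij =>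
      (tdisj hij).mono inter_subset_right inter_subset_right
    have hsU : s = ⋃ n, s ∩ t n := by rw [← inter_iUnion, inter_eq_left.2 tcov]
    have hsum1 : μHE[d] (f '' s) = ∑' n, μHE[d] (f '' (s ∩ t n)) := by
      conv_lhs => rw [hsU]
      rw [image_iUnion]
      refine measure_iUnion (fun i j hij => ?_) fun n =>
        (hsn n).image_of_continuousOn_injOn hc.continuousOn hf.injective.injOn
      exact (disjoint_image_iff hf.injective).2 (hdisj hij)
    have hsum2 : ∫⁻ x in s, ENNReal.ofReal (f' x).toLinearMap.normDet =
        ∑' n, ∫⁻ x in s ∩ t n, ENNReal.ofReal (f' x).toLinearMap.normDet := by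
      conv_lhs => rw [hsU]
      exact lintegral_iUnion hsn hdisj _
    have hKtop : (K : ℝ≥0∞) ^ d ≠ ⊤ := ENNReal.pow_ne_top ENNReal.coe_ne_top
    have hpiece : ∀ n, ENNReal.ofReal (A n).toLinearMap.normDet * volume (s ∩ t n) ≤
          (K : ℝ≥0∞) ^ d * ∫⁻ x in s ∩ t n, ENNReal.ofReal (f' x).toLinearMap.normDet ∧
        ∫⁻ x in s ∩ t n, ENNReal.ofReal (f' x).toLinearMap.normDet ≤
          (K : ℝ≥0∞) ^ d * (ENNReal.ofReal (A n).toLinearMap.normDet * volume (s ∩ t n)) := by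
      intro n
      have hae := norm_fderiv_sub_le_of_approximatesLinearOn volume (tapp n) (hsn n) f'
        fun x hx => (hf' x hx.1).hasFDerivWithinAt
      constructor
      · rw [← setLIntegral_const, ← lintegral_const_mul' _ _ hKtop]
        refine lintegral_mono_ae ?_
        filter_upwards [hae] with x hx
        exact (normDet_bounds_of_norm_sub_le hK (hA n) hδ hx).2
      · rw [← mul_assoc, ← setLIntegral_const]
        refine lintegral_mono_ae ?_
        filter_upwards [hae] with x hx
        exact (normDet_bounds_of_norm_sub_le hK (hA n) hδ hx).1
    rw [hsum1, hsum2, ← ENNReal.tsum_mul_left, ← ENNReal.tsum_mul_left]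
    constructor
    · refine ENNReal.tsum_le_tsum fun n => ?_
      refine (euclideanHausdorffMeasure_image_bounds hK (hA n) hδ (tapp n)).1.trans ?_
      rw [mul_assoc]
      exact mul_le_mul' le_rfl (hpiece n).1
    · refine ENNReal.tsum_le_tsum fun n => (hpiece n).2.trans ?_
      rw [mul_assoc]
      exact mul_le_mul' le_rfl (euclideanHausdorffMeasure_image_bounds hK (hA n) hδ (tapp n)).2
  have hlim : ∀ b : ℝ≥0∞, Tendsto (fun K : ℝ≥0 => ((K : ℝ≥0∞) ^ d * (K : ℝ≥0∞) ^ d) * b)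
      (𝓝[>] 1) (𝓝 b) := by
    intro b
    have h1 : Tendsto (fun K : ℝ≥0 => ((K ^ d * K ^ d : ℝ≥0) : ℝ≥0∞)) (𝓝[>] 1) (𝓝 1) := by
      have : Tendsto (fun K : ℝ≥0 => ((K ^ d * K ^ d : ℝ≥0) : ℝ≥0∞)) (𝓝 1)
          (𝓝 (((1 : ℝ≥0) ^ d * 1 ^ d : ℝ≥0) : ℝ≥0∞)) :=
        Continuous.tendsto (by fun_prop) 1
      simpa using this.mono_left nhdsWithin_le_nhds
    simpa using ENNReal.Tendsto.mul_const h1 (b := b) (Or.inl one_ne_zero)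
  have hne : (𝓝[>] (1 : ℝ≥0)).NeBot := inferInstance
  apply le_antisymm
  · refine ge_of_tendsto (hlim _) ?_
    filter_upwards [self_mem_nhdsWithin] with K hK using (main K hK).1
  · refine ge_of_tendsto (hlim _) ?_
    filter_upwards [self_mem_nhdsWithin] with K hK using (main K hK).2

end AreaFormula

/-! ### Lipschitz graphs: surface measure and normal -/

/-- The Euclidean plane. -/
abbrev E2 : Type := EuclideanSpace ℝ (Fin 2)

/-- The orthogonal sum of the Euclidean plane and a line. -/
abbrev PlaneLine : Type := WithLp 2 (E2 × ℝ)

/-- Parametrization of the graph of `g` in the coordinates given by `T`. -/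
noncomputable def graphChart (T : E3 ≃ₗᵢ[ℝ] PlaneLine) (g : E2 → ℝ) (x : E2) : E3 :=
  T.symm (WithLp.toLp 2 (x, g x))

/-- The derivative of a graph parametrization, for the derivative `L` of the function. -/
noncomputable def graphDeriv (T : E3 ≃ₗᵢ[ℝ] PlaneLine) (L : E2 →L[ℝ] ℝ) : E2 →L[ℝ] E3 :=
  T.symm.toContinuousLinearEquiv.toContinuousLinearMap ∘L
    (WithLp.prodContinuousLinearEquiv 2 ℝ E2 ℝ).symm.toContinuousLinearMap ∘L
      (ContinuousLinearMap.id ℝ E2).prod L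

/-- The direction orthogonal to the graph of a function with derivative `L`, pointing up. -/
noncomputable def upwardNormal (T : E3 ≃ₗᵢ[ℝ] PlaneLine) (L : E2 →L[ℝ] ℝ) : E3 :=
  T.symm (WithLp.toLp 2 (-(InnerProductSpace.toDual ℝ E2).symm L, 1))

variable {T : E3 ≃ₗᵢ[ℝ] PlaneLine} {g : E2 → ℝ} {K : ℝ≥0}

theorem continuous_fst_apply (T : E3 ≃ₗᵢ[ℝ] PlaneLine) : Continuous fun X : E3 => (T X).fst :=
  continuous_fst.comp ((WithLp.prod_continuous_ofLp 2 E2 ℝ).comp T.continuous)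

theorem continuous_snd_apply (T : E3 ≃ₗᵢ[ℝ] PlaneLine) : Continuous fun X : E3 => (T X).snd :=
  continuous_snd.comp ((WithLp.prod_continuous_ofLp 2 E2 ℝ).comp T.continuous)

theorem apply_graphChart (x : E2) : T (graphChart T g x) = WithLp.toLp 2 (x, g x) := by
  simp [graphChart]

theorem graphDeriv_apply (L : E2 →L[ℝ] ℝ) (v : E2) :
    graphDeriv T L v = T.symm (WithLp.toLp 2 (v, L v)) := rfl

theorem norm_upwardNormal_sq (L : E2 →L[ℝ] ℝ) : ‖upwardNormal T L‖ ^ 2 = 1 + ‖L‖ ^ 2 := by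
  rw [upwardNormal, LinearIsometryEquiv.norm_map, WithLp.prod_norm_sq_eq_of_L2]
  simp [add_comm]

theorem norm_upwardNormal (L : E2 →L[ℝ] ℝ) : ‖upwardNormal T L‖ = √(1 + ‖L‖ ^ 2) := by
  rw [← norm_upwardNormal_sq (T := T), Real.sqrt_sq (norm_nonneg _)]

theorem one_le_norm_upwardNormal (L : E2 →L[ℝ] ℝ) : 1 ≤ ‖upwardNormal T L‖ := by
  rw [norm_upwardNormal, Real.one_le_sqrt]
  nlinarith [sq_nonneg ‖L‖]

theorem inner_upwardNormal (L : E2 →L[ℝ] ℝ) (X : E3) :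
    ⟪X, upwardNormal T L⟫ = (T X).snd - L (T X).fst := by
  rw [upwardNormal, ← LinearIsometryEquiv.inner_map_map T, LinearIsometryEquiv.apply_symm_apply,
    WithLp.prod_inner_apply]
  simp only [inner_neg_right]
  rw [real_inner_comm, InnerProductSpace.toDual_symm_apply]
  simp
  ring

theorem continuous_upwardNormal : Continuous (upwardNormal T) := by
  unfold upwardNormal
  refine T.symm.continuous.comp ((WithLp.prod_continuous_toLp 2 E2 ℝ).comp ?_)
  exact ((InnerProductSpace.toDual ℝ E2).symm.continuous.neg).prodMk continuous_const

/-- The Gram matrix of the derivative is the identity plus a rank-one matrix built from `L`. The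
value is also `‖upwardNormal T L‖`, so the area factor will cancel the normalization of the normal.
-/
theorem normDet_graphDeriv (L : E2 →L[ℝ] ℝ) :
    (graphDeriv T L).toLinearMap.normDet = √(1 + ‖L‖ ^ 2) := by
  have h := (graphDeriv T L).toLinearMap.normDet_sq_eq_det_gram (EuclideanSpace.basisFun (Fin 2) ℝ)
  set a := (InnerProductSpace.toDual ℝ E2).symm L with ha
  have hL : ∀ i, L (EuclideanSpace.single i 1) = a i := by
    intro i
    rw [← InnerProductSpace.toDual_symm_apply, ← ha, EuclideanSpace.inner_single_right]
    simp
  have hn : ‖L‖ ^ 2 = a 0 ^ 2 + a 1 ^ 2 := by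
    rw [← LinearIsometryEquiv.norm_map (InnerProductSpace.toDual ℝ E2).symm L, ← ha,
      EuclideanSpace.real_norm_sq_eq, Fin.sum_univ_two]
  rw [eq_comm, Real.sqrt_eq_iff_mul_self_eq (by positivity) (LinearMap.normDet_nonneg _), ← sq]
  have hg : ∀ v w, ⟪graphDeriv T L v, graphDeriv T L w⟫ = ⟪v, w⟫ + L v * L w := by
    intro v w
    rw [graphDeriv_apply, graphDeriv_apply, LinearIsometryEquiv.inner_map_map,
      WithLp.prod_inner_apply]
    simp [mul_comm]
  rw [RCLike.ofReal_real_eq_id, id] at h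
  rw [h, Matrix.det_fin_two]
  simp only [Matrix.gram_apply, ContinuousLinearMap.coe_coe, hg]
  simp [hL, hn, EuclideanSpace.inner_single_left]
  ring

theorem antilipschitzWith_graphChart : AntilipschitzWith 1 (graphChart T g) := by
  refine AntilipschitzWith.of_le_mul_dist fun x y => ?_
  rw [graphChart, graphChart, LinearIsometryEquiv.dist_map, WithLp.prod_dist_eq_of_L2]
  simp only [NNReal.coe_one, one_mul]
  exact Real.le_sqrt_of_sq_le (by simp)

theorem lipschitzWith_graphChart (hg : LipschitzWith K g) :
    LipschitzWith (1 + K) (graphChart T g) := by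
  refine LipschitzWith.of_dist_le_mul fun x y => ?_
  rw [graphChart, graphChart, LinearIsometryEquiv.dist_map, WithLp.prod_dist_eq_of_L2]
  have := hg.dist_le_mul x y
  refine Real.sqrt_le_iff.2 ⟨by positivity, ?_⟩
  simp only [NNReal.coe_add, NNReal.coe_one, WithLp.toLp_fst, WithLp.toLp_snd]
  nlinarith [@dist_nonneg _ _ x y, @dist_nonneg _ _ (g x) (g y), K.2,
    mul_nonneg K.2 (@dist_nonneg _ _ x y)]

theorem measurableEmbedding_graphChart (hg : LipschitzWith K g) :
    MeasurableEmbedding (graphChart T g) :=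
  (antilipschitzWith_graphChart.isClosedEmbedding
    (lipschitzWith_graphChart hg).uniformContinuous).measurableEmbedding

theorem hasFDerivAt_graphChart {L : E2 →L[ℝ] ℝ} {x : E2} (h : HasFDerivAt g L x) :
    HasFDerivAt (graphChart T g) (graphDeriv T L) x :=
  (T.symm.toContinuousLinearEquiv.toContinuousLinearMap ∘L
    (WithLp.prodContinuousLinearEquiv 2 ℝ E2 ℝ).symm.toContinuousLinearMap).hasFDerivAt.comp x
      ((hasFDerivAt_id x).prodMk h)

/-- Surface measure on a Lipschitz graph. -/
theorem map_graphChart (hg : LipschitzWith K g) :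
    (volume.withDensity fun x => ENNReal.ofReal √(1 + ‖fderiv ℝ g x‖ ^ 2)).map (graphChart T g) =
      (μHE[2] : Measure E3).restrict (range (graphChart T g)) := by
  have hemb := measurableEmbedding_graphChart (T := T) hg
  ext t ht
  set s := graphChart T g ⁻¹' t with hs_def
  have hs : MeasurableSet s := hemb.measurable ht
  set D := {x | DifferentiableAt ℝ g x}
  have hD : MeasurableSet D := measurableSet_of_differentiableAt ℝ g
  have hDc : volume (s \ D) = 0 :=
    measure_mono_null (sdiff_subset_compl _ _) hg.ae_differentiableAt
  rw [hemb.map_apply, withDensity_apply _ hs, Measure.restrict_apply ht,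
    ← image_preimage_eq_inter_range, ← hs_def]
  have h1 : ∫⁻ x in s, ENNReal.ofReal √(1 + ‖fderiv ℝ g x‖ ^ 2) =
      ∫⁻ x in s ∩ D, ENNReal.ofReal √(1 + ‖fderiv ℝ g x‖ ^ 2) :=
    (setLIntegral_congr (inter_ae_eq_left_of_ae_eq_univ
      (ae_eq_univ.2 hg.ae_differentiableAt))).symm
  have h2 := euclideanHausdorffMeasure_image_eq_lintegral (f := graphChart T g)
    (f' := fun x => graphDeriv T (fderiv ℝ g x)) (hs.inter hD) antilipschitzWith_graphChart
    (lipschitzWith_graphChart hg).continuous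
    fun x hx => hasFDerivAt_graphChart hx.2.hasFDerivAt
  simp only [normDet_graphDeriv, finrank_euclideanSpace, Fintype.card_fin] at h2
  rw [h1, ← h2]
  -- By Rademacher the non-differentiability set is Lebesgue null, and the Lipschitz chart sends it
  -- to a set of area zero.
  have h3 : μHE[2] (graphChart T g '' (s \ D)) = 0 := by
    have h4 := euclideanHausdorffMeasure_image_le_of_dist_le 2 (K := 1 + K) (s := s \ D)
      (f := graphChart T g) (g := id) fun x _ y _ => (lipschitzWith_graphChart hg).dist_le_mul x y
    rw [image_id, EuclideanSpace.euclideanHausdorffMeasure_eq_volume, hDc, mul_zero] at h4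
    exact le_antisymm h4 zero_le
  refine le_antisymm (measure_mono (image_mono inter_subset_left)) ?_
  calc μHE[2] (graphChart T g '' s)
      = μHE[2] (graphChart T g '' (s ∩ D) ∪ graphChart T g '' (s \ D)) := by
        rw [← image_union, inter_union_sdiff]
    _ ≤ _ := by simpa [h3] using measure_union_le (μ := (μHE[2] : Measure E3))
                  (graphChart T g '' (s ∩ D)) (graphChart T g '' (s \ D))

theorem outerNormal_eq {A : Set E3} {y n : E3} (h : IsOuterUnitNormal A y n) :
    outerNormal A y = n := by
  have hex : ∃ n, IsOuterUnitNormal A y n := ⟨n, h⟩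
  rw [outerNormal, dif_pos hex]
  exact hex.choose_spec.unique h

theorem norm_outerNormal_le (A : Set E3) (y : E3) : ‖outerNormal A y‖ ≤ 1 := by
  unfold outerNormal
  split_ifs with h
  · exact h.choose_spec.1.le
  · simp

/-- The outer normal of a region below a graph, at a point of differentiability. -/
theorem outerNormal_graphChart {A : Set E3} {L : E2 →L[ℝ] ℝ} {x : E2} (h : HasFDerivAt g L x)
    (hA : ∀ᶠ X in 𝓝 (graphChart T g x),
      ((T X).snd < g (T X).fst → X ∈ A) ∧ (g (T X).fst < (T X).snd → X ∉ A)) :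
    outerNormal A (graphChart T g x) = ‖upwardNormal T L‖⁻¹ • upwardNormal T L := by
  have hq := one_le_norm_upwardNormal (T := T) L
  have hq0 : 0 < ‖upwardNormal T L‖ := by linarith
  refine outerNormal_eq ⟨?_, fun ε hε => ?_⟩
  · rw [norm_smul, norm_inv, norm_norm, inv_mul_cancel₀ hq0.ne']
  have hT : Tendsto (fun X : E3 => (T X).fst) (𝓝 (graphChart T g x)) (𝓝 x) := by
    simpa [apply_graphChart] using (continuous_fst_apply T).tendsto (graphChart T g x)
  filter_upwards [hA, hT.eventually (h.isLittleO.def hε)] with X hX hlin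
  have hin : ⟪X - graphChart T g x, ‖upwardNormal T L‖⁻¹ • upwardNormal T L⟫ =
      ‖upwardNormal T L‖⁻¹ * ((T X).snd - g x - L ((T X).fst - x)) := by
    rw [inner_smul_right, inner_upwardNormal, map_sub, apply_graphChart]
    simp
  have hfst : ‖(T X).fst - x‖ ≤ ‖X - graphChart T g x‖ := by
    rw [← LinearIsometryEquiv.norm_map T (X - _), map_sub, apply_graphChart,
      WithLp.prod_norm_eq_of_L2]
    exact Real.le_sqrt_of_sq_le (by simp; positivity)
  rw [Real.norm_eq_abs] at hlin
  have hlin' := abs_le.1 (hlin.trans (mul_le_mul_of_nonneg_left hfst hε.le))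
  set r := ‖X - graphChart T g x‖
  have hr0 : 0 ≤ r := norm_nonneg _
  -- Undoing the normalization multiplies the margin `ε * r` by a norm that is at least one, so it
  -- still beats the linearization error of `g`.
  have hqr : ε * r ≤ ‖upwardNormal T L‖ * (ε * r) := le_mul_of_one_le_left (by positivity) hq
  rw [hin]
  constructor
  · intro hlt
    rw [inv_mul_lt_iff₀ hq0] at hlt
    exact hX.1 (by linarith)
  · intro hlt
    rw [lt_inv_mul_iff₀ hq0] at hlt
    exact hX.2 (by linarith)

/-! ### The divergence theorem below a Lipschitz graph -/

section Subgraph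

variable {E : Type*} [NormedAddCommGroup E] [InnerProductSpace ℝ E] [FiniteDimensional ℝ E]
  [MeasurableSpace E] [BorelSpace E] {g : E → ℝ} {K : ℝ≥0}

/-- The homeomorphism moving the points of a product up by the values of `g`. -/
def shear {E : Type*} [TopologicalSpace E] (g : E → ℝ) (hg : Continuous g) :
    E × ℝ ≃ₜ E × ℝ where
  toFun z := (z.1, z.2 + g z.1)
  invFun z := (z.1, z.2 - g z.1)
  left_inv z := by simp
  right_inv z := by simp
  continuous_toFun := by fun_prop
  continuous_invFun := by fun_prop

theorem measurePreserving_shear (hg : Continuous g) : MeasurePreserving (shear g hg) := by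
  have h : MeasurePreserving (fun z : E × ℝ => (id z.1, z.2 + g z.1))
      ((volume : Measure E).prod (volume : Measure ℝ))
      ((volume : Measure E).prod (volume : Measure ℝ)) := by
    refine (MeasurePreserving.id volume).skew_product (g := fun x t => t + g x) ?_ ?_
    · exact (by fun_prop : Continuous fun z : E × ℝ => z.2 + g z.1).measurable
    · exact Eventually.of_forall fun x => map_add_right_eq_self volume (g x)
  exact h

/-- The integral of a directional derivative of a compactly supported Lipschitz function is zero. -/
theorem integral_lineDeriv_eq_zero {f : E → ℝ} (hf : LipschitzWith K f) (hc : HasCompactSupport f)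
    (v : E) : ∫ x, lineDeriv ℝ f x v = 0 := by
  -- Integration by parts against the constant one, which reverses the direction; hence `-v`.
  have h := (LipschitzWith.const (1 : ℝ) : LipschitzWith 0 fun _ : E => (1 : ℝ)).integral_lineDeriv_mul_eq
    (μ := volume) hf hc (-v)
  have h0 : ∀ x : E, lineDeriv ℝ (fun _ : E => (1 : ℝ)) x (-v) = 0 := fun x => by simp [lineDeriv]
  simp only [h0, zero_mul, integral_zero, neg_neg, mul_one] at h
  exact h.symm

/-- The divergence theorem below the graph of a Lipschitz function. -/
theorem setIntegral_fderiv_subgraph {q : E × ℝ → ℝ} (hq : ContDiff ℝ 1 q)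
    (hc : HasCompactSupport q) (hg : LipschitzWith K g) (w : E × ℝ) :
    ∫ z in {z : E × ℝ | z.2 ≤ g z.1}, fderiv ℝ q z w =
      ∫ x, q (x, g x) * (w.2 - fderiv ℝ g x w.1) := by
  set S := shear g hg.continuous
  have hSp : MeasurePreserving S volume volume := measurePreserving_shear hg.continuous
  have hSa : ∀ x t, S (x, t) = (x, t + g x) := fun _ _ => rfl
  have hpre : S ⁻¹' {z : E × ℝ | z.2 ≤ g z.1} = univ ×ˢ Iic (0 : ℝ) := by
    ext ⟨x, t⟩; simp [hSa]
  have hD : Continuous (fderiv ℝ q) := hq.continuous_fderiv one_ne_zero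
  have hDc : HasCompactSupport (fderiv ℝ q) := hc.fderiv ℝ
  have hdir : ∀ u, Integrable (fun z => fderiv ℝ q z u) := fun u =>
    (hD.clm_apply continuous_const).integrable_of_hasCompactSupport
      (hDc.comp_left (g := fun L : E × ℝ →L[ℝ] ℝ => L u) rfl)
  have hbdd : ∀ x, ‖fderiv ℝ g x w.1‖ ≤ K * ‖w.1‖ := fun x =>
    (ContinuousLinearMap.le_opNorm _ _).trans
      (by gcongr; exact norm_fderiv_le_of_lipschitz ℝ hg)
  have hmeas : Measurable fun z : E × ℝ => fderiv ℝ g z.1 w.1 :=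
    (measurable_fderiv_apply_const ℝ g w.1).comp measurable_fst
  have hvert : ∀ c : ℝ, Integrable fun z : E × ℝ =>
      (c - fderiv ℝ g z.1 w.1) * fderiv ℝ q z (0, 1) := fun c =>
    (hdir (0, 1)).bdd_mul (c := |c| + K * ‖w.1‖) (measurable_const.sub hmeas).aestronglyMeasurable
      (Eventually.of_forall fun z => (norm_sub_le _ _).trans (by gcongr; exacts [le_rfl, hbdd _]))
  -- Split `w` into a part tangent to the graph and a vertical part. After the shear, the tangential
  -- part is a derivative along horizontal slices and integrates to zero. The vertical part is
  -- handled on each line by the fundamental theorem of calculus, leaving the boundary value at the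
  -- graph.
  set F : E × ℝ → ℝ := fun z => fderiv ℝ q z (w.1, fderiv ℝ g z.1 w.1)
  set G : E × ℝ → ℝ := fun z => (w.2 - fderiv ℝ g z.1 w.1) * fderiv ℝ q z (0, 1) with hG
  have hFG : ∀ z, fderiv ℝ q z w = F z + G z := by
    intro z
    have : w = (w.1, fderiv ℝ g z.1 w.1) + (w.2 - fderiv ℝ g z.1 w.1) • ((0 : E), (1 : ℝ)) := by
      ext <;> simp
    conv_lhs => rw [this, map_add, map_smul, smul_eq_mul]
  have hGi : Integrable G := hvert w.2
  have hFi : Integrable F := by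
    have : F = fun z => fderiv ℝ q z w - G z := funext fun z => by rw [hFG]; ring
    rw [this]
    exact (hdir w).sub hGi
  have hFS := hSp.integrable_comp_of_integrable hFi
  have hGS := hSp.integrable_comp_of_integrable hGi
  rw [← hSp.setIntegral_preimage_emb S.measurableEmbedding, hpre]
  simp only [hFG]
  rw [integral_add (f := fun z => F (S z)) (g := fun z => G (S z)) hFS.integrableOn
    hGS.integrableOn]
  have hvol : (volume : Measure (E × ℝ)).restrict (univ ×ˢ Iic 0) =
      (volume : Measure E).prod (volume.restrict (Iic (0 : ℝ))) := by
    have := Measure.prod_restrict (μ := (volume : Measure E)) (ν := (volume : Measure ℝ)) univ (Iic 0)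
    rw [Measure.restrict_univ] at this
    rw [this, Measure.volume_eq_prod]
  have h1 : ∫ z in univ ×ˢ Iic (0 : ℝ), F (S z) = 0 := by
    have hi : Integrable (fun z => F (S z))
        ((volume : Measure E).prod (volume.restrict (Iic (0 : ℝ)))) := by
      rw [← hvol]; exact hFS.integrableOn
    rw [hvol, integral_prod_symm _ hi]
    refine integral_eq_zero_of_ae (Eventually.of_forall fun t => ?_)
    obtain ⟨C, hC⟩ := hq.lipschitzWith_of_hasCompactSupport hc one_ne_zero
    have hLip := hC.comp (LipschitzWith.id.prodMk ((LipschitzWith.const t).add hg))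
    have hcs : HasCompactSupport fun x => q (x, t + g x) := by
      refine HasCompactSupport.intro (K := Prod.fst '' tsupport q)
        (hc.isCompact.image continuous_fst) fun x hx => ?_
      by_contra hne
      exact hx ⟨_, subset_tsupport _ hne, rfl⟩
    rw [Pi.zero_apply, ← integral_lineDeriv_eq_zero hLip hcs w.1]
    refine integral_congr_ae ?_
    filter_upwards [hg.ae_differentiableAt (μ := volume)] with x hx
    have hd : HasFDerivAt (fun x => q (x, t + g x))
        ((fderiv ℝ q (x, t + g x)).comp
          ((ContinuousLinearMap.id ℝ E).prod (fderiv ℝ g x))) x :=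
      HasFDerivAt.comp x (hq.differentiable one_ne_zero _).hasFDerivAt
        ((hasFDerivAt_id x).prodMk (hx.hasFDerivAt.const_add t))
    exact (hd.hasLineDerivAt w.1).lineDeriv.symm
  have h2 : ∫ z in univ ×ˢ Iic (0 : ℝ), G (S z) = ∫ x, q (x, g x) * (w.2 - fderiv ℝ g x w.1) := by
    have hi : Integrable (fun z => G (S z))
        ((volume : Measure E).prod (volume.restrict (Iic (0 : ℝ)))) := by
      rw [← hvol]; exact hGS.integrableOn
    rw [hvol, integral_prod _ hi]
    refine integral_congr_ae (Eventually.of_forall fun x => ?_)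
    have hline : ContDiff ℝ 1 fun t : ℝ => q (x, t + g x) :=
      hq.comp (contDiff_const.prodMk (contDiff_id.add contDiff_const))
    have hcs : HasCompactSupport fun t : ℝ => q (x, t + g x) := by
      refine HasCompactSupport.intro (K := (fun z : E × ℝ => z.2 - g x) '' tsupport q)
        (hc.isCompact.image (by fun_prop)) fun t ht => ?_
      by_contra hne
      exact ht ⟨_, subset_tsupport _ hne, by simp⟩
    have hder : ∀ t : ℝ, fderiv ℝ q (x, t + g x) (0, 1) = deriv (fun t : ℝ => q (x, t + g x)) t := by
      intro t
      have := HasFDerivAt.comp_hasDerivAt t (hq.differentiable one_ne_zero (x, t + g x)).hasFDerivAt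
        ((hasDerivAt_const t x).prodMk ((hasDerivAt_id t).add_const (g x)))
      exact this.deriv.symm
    simp only [hG, hSa, hder, integral_const_mul]
    rw [hcs.integral_Iic_deriv_eq hline, zero_add, mul_comm]
  rw [h1, h2, zero_add]

theorem measurableSet_graph {E : Type*} [TopologicalSpace E] [SecondCountableTopology E]
    [MeasurableSpace E] [BorelSpace E] {g : E → ℝ} (hg : Continuous g) :
    MeasurableSet {z : E × ℝ | z.2 = g z.1} :=
  (isClosed_eq continuous_snd (hg.comp continuous_fst)).measurableSet

/-- Graphs of continuous functions are null sets. -/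
theorem volume_graph_eq_zero (hg : Continuous g) :
    volume {z : E × ℝ | z.2 = g z.1} = 0 := by
  rw [Measure.volume_eq_prod, Measure.measure_prod_null (measurableSet_graph hg)]
  refine Eventually.of_forall fun x => ?_
  have : Prod.mk x ⁻¹' {z : E × ℝ | z.2 = g z.1} = {g x} := by ext t; simp
  simp [this]

end Subgraph

/-! ### The divergence theorem near a Lipschitz boundary point -/

section Chart

variable {T : E3 ≃ₗᵢ[ℝ] PlaneLine} {g : E2 → ℝ} {K : ℝ≥0}

/-- The coordinates given by `T`, in the product of the plane and a line. -/
noncomputable def chartCoord (T : E3 ≃ₗᵢ[ℝ] PlaneLine) : E3 ≃L[ℝ] E2 × ℝ :=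
  T.toContinuousLinearEquiv.trans (WithLp.prodContinuousLinearEquiv 2 ℝ E2 ℝ)

theorem measurePreserving_chartCoord : MeasurePreserving (chartCoord T) :=
  (WithLp.volume_preserving_ofLp E2 ℝ).comp T.measurePreserving

theorem setIntegral_fderiv_below_graphChart {φ : E3 → ℝ} (hφ : ContDiff ℝ 1 φ)
    (hc : HasCompactSupport φ) (hg : LipschitzWith K g) (v : E3) :
    ∫ X in {X : E3 | (T X).snd ≤ g (T X).fst}, fderiv ℝ φ X v =
      ∫ x, φ (graphChart T g x) * ⟪v, upwardNormal T (fderiv ℝ g x)⟫ := by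
  set m := chartCoord T
  have hq : ContDiff ℝ 1 (φ ∘ m.symm) := hφ.comp m.symm.contDiff
  have hqc : HasCompactSupport (φ ∘ m.symm) := hc.comp_homeomorph m.symm.toHomeomorph
  have hmain := setIntegral_fderiv_subgraph hq hqc hg (m v)
  have hpre : m ⁻¹' {z : E2 × ℝ | z.2 ≤ g z.1} = {X : E3 | (T X).snd ≤ g (T X).fst} := rfl
  rw [← (measurePreserving_chartCoord (T := T)).setIntegral_preimage_emb
    m.toHomeomorph.measurableEmbedding, hpre] at hmain
  have hder : ∀ X, fderiv ℝ (φ ∘ m.symm) (m X) (m v) = fderiv ℝ φ X v := by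
    intro X
    rw [m.symm.comp_right_fderiv]
    simp
  rw [← integral_congr_ae (Eventually.of_forall hder)]
  refine hmain.trans (integral_congr_ae (Eventually.of_forall fun x => ?_))
  simp only [inner_upwardNormal]
  rfl

theorem mem_range_graphChart_iff {X : E3} :
    X ∈ range (graphChart T g) ↔ (T X).snd = g (T X).fst := by
  constructor
  · rintro ⟨x, rfl⟩
    simp [apply_graphChart]
  · intro h
    refine ⟨(T X).fst, ?_⟩
    rw [graphChart, ← h]
    exact T.symm_apply_apply X

theorem volume_range_graphChart (hg : Continuous g) :
    volume (range (graphChart T g)) = 0 := by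
  have h : range (graphChart T g) = chartCoord T ⁻¹' {z : E2 × ℝ | z.2 = g z.1} := by
    ext X
    exact mem_range_graphChart_iff
  rw [h, measurePreserving_chartCoord.measure_preimage
    (measurableSet_graph hg).nullMeasurableSet]
  exact volume_graph_eq_zero hg

end Chart

/-! ### Frontier, outer normal and divergence theorem in one chart. -/

section Chart

variable {T : E3 ≃ₗᵢ[ℝ] PlaneLine} {g : E2 → ℝ} {K : ℝ≥0}

/-- Where `A` lies below the graph of a continuous function, its frontier is the graph. -/
theorem frontier_inter_eq_graph_inter {A U : Set E3} (hg : Continuous g) (hU : IsOpen U)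
    (hA : ∀ X ∈ U, ((T X).snd < g (T X).fst → X ∈ A) ∧ (g (T X).fst < (T X).snd → X ∉ A)) :
    frontier A ∩ U = range (graphChart T g) ∩ U := by
  have hfst := continuous_fst_apply T
  have hsnd := continuous_snd_apply T
  ext X
  refine and_congr_left fun hXU => ?_
  rw [mem_range_graphChart_iff]
  constructor
  · intro hX
    rcases lt_trichotomy (T X).snd (g (T X).fst) with h | h | h
    · refine absurd (mem_interior_iff_mem_nhds.2 ?_) hX.2
      filter_upwards [hU.mem_nhds hXU, (isOpen_lt hsnd (hg.comp hfst)).mem_nhds h] with Y h1 h2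
      exact (hA Y h1).1 h2
    · exact h
    · refine absurd hX.1 (mem_compl_iff _ _ |>.1 ?_)
      rw [← interior_compl, mem_interior_iff_mem_nhds]
      filter_upwards [hU.mem_nhds hXU, (isOpen_lt (hg.comp hfst) hsnd).mem_nhds h] with Y h1 h2
      exact (hA Y h1).2 h2
  · intro hX
    -- Points just below and just above `X` on the vertical axis of the chart show that `X` is a
    -- limit both of `A` and of its complement.
    have hlim : ∀ c : ℝ, Tendsto (fun t : ℝ => X + (t * c) • T.symm (WithLp.toLp 2 (0, 1)))
        (𝓝[>] 0) (𝓝 X) := by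
      intro c
      have : Tendsto (fun t : ℝ => X + (t * c) • T.symm (WithLp.toLp 2 (0, 1))) (𝓝 0)
          (𝓝 (X + ((0 : ℝ) * c) • T.symm (WithLp.toLp 2 (0, 1)))) :=
        Continuous.tendsto (by fun_prop) 0
      simpa using this.mono_left nhdsWithin_le_nhds
    have hT : ∀ s : ℝ, T (X + s • T.symm (WithLp.toLp 2 (0, 1))) =
        T X + s • WithLp.toLp 2 (0, 1) := fun s => by simp
    rw [frontier_eq_closure_inter_closure]
    constructor
    · refine mem_closure_of_tendsto (hlim (-1)) ?_
      filter_upwards [(hlim (-1)).eventually (hU.mem_nhds hXU), self_mem_nhdsWithin] with t ht ht0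
      have ht0' : (0 : ℝ) < t := ht0
      refine (hA _ ht).1 ?_
      rw [hT]
      simp [hX, ht0']
    · refine mem_closure_of_tendsto (hlim 1) ?_
      filter_upwards [(hlim 1).eventually (hU.mem_nhds hXU), self_mem_nhdsWithin] with t ht ht0
      have ht0' : (0 : ℝ) < t := ht0
      refine (hA _ ht).2 ?_
      rw [hT]
      simp [hX, ht0']

theorem ae_outerNormal_graphChart {A U : Set E3} (hg : LipschitzWith K g) (hU : IsOpen U)
    (hA : ∀ X ∈ U, ((T X).snd < g (T X).fst → X ∈ A) ∧ (g (T X).fst < (T X).snd → X ∉ A)) :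
    ∀ᵐ x : E2, graphChart T g x ∈ U → outerNormal A (graphChart T g x) =
      ‖upwardNormal T (fderiv ℝ g x)‖⁻¹ • upwardNormal T (fderiv ℝ g x) := by
  filter_upwards [hg.ae_differentiableAt (μ := volume)] with x hx hxU
  refine outerNormal_graphChart hx.hasFDerivAt ?_
  filter_upwards [hU.mem_nhds hxU] with X hX using hA X hX

/-- `outerNormal` is defined by pointwise choice, so measurability is not automatic. In the chart it
agrees almost everywhere with an expression in the measurable derivative of `g`. -/
theorem aestronglyMeasurable_outerNormal_chart {A U : Set E3} (hg : LipschitzWith K g)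
    (hU : IsOpen U)
    (hA : ∀ X ∈ U, ((T X).snd < g (T X).fst → X ∈ A) ∧ (g (T X).fst < (T X).snd → X ∉ A)) :
    AEStronglyMeasurable (outerNormal A) ((μHE[2] : Measure E3).restrict (frontier A ∩ U)) := by
  have hemb := measurableEmbedding_graphChart (T := T) hg
  rw [frontier_inter_eq_graph_inter hg.continuous hU hA, inter_comm,
    ← Measure.restrict_restrict hU.measurableSet, ← map_graphChart hg, hemb.restrict_map,
    hemb.aestronglyMeasurable_map_iff]
  have hm : Measurable fun x => upwardNormal T (fderiv ℝ g x) :=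
    continuous_upwardNormal.measurable.comp (measurable_fderiv ℝ g)
  refine AEStronglyMeasurable.congr (hm.norm.inv.smul hm).aestronglyMeasurable ?_
  have h1 := (withDensity_absolutelyContinuous volume
    fun x => ENNReal.ofReal √(1 + ‖fderiv ℝ g x‖ ^ 2)).ae_le (ae_outerNormal_graphChart hg hU hA)
  filter_upwards [ae_restrict_of_ae h1, ae_restrict_mem (hemb.measurable hU.measurableSet)]
    with x hx hxU
  exact (hx hxU).symm

/-- The area density is the norm of the upward normal, so it cancels against the normalization and
no square root survives. Because `φ` vanishes off `U`, the frontier may be replaced by the whole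
graph. -/
theorem setIntegral_frontier_chart {A U : Set E3} (hg : LipschitzWith K g) (hU : IsOpen U)
    (hA : ∀ X ∈ U, ((T X).snd < g (T X).fst → X ∈ A) ∧ (g (T X).fst < (T X).snd → X ∉ A))
    {φ : E3 → ℝ} (hφU : ∀ X ∉ U, φ X = 0) (v : E3) :
    ∫ y in frontier A, φ y * ⟪v, outerNormal A y⟫ ∂μHE[2] =
      ∫ x, φ (graphChart T g x) * ⟪v, upwardNormal T (fderiv ℝ g x)⟫ := by
  have hemb := measurableEmbedding_graphChart (T := T) hg
  have h1 : ∫ y in frontier A, φ y * ⟪v, outerNormal A y⟫ ∂μHE[2] =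
      ∫ y in frontier A ∩ U, φ y * ⟪v, outerNormal A y⟫ ∂μHE[2] := by
    refine setIntegral_eq_of_subset_of_forall_sdiff_eq_zero isClosed_frontier.measurableSet
      inter_subset_left fun y hy => ?_
    rw [hφU y fun h => hy.2 ⟨hy.1, h⟩, zero_mul]
  have h2 : ∫ y in range (graphChart T g), φ y * ⟪v, outerNormal A y⟫ ∂μHE[2] =
      ∫ y in range (graphChart T g) ∩ U, φ y * ⟪v, outerNormal A y⟫ ∂μHE[2] := by
    refine setIntegral_eq_of_subset_of_forall_sdiff_eq_zero hemb.measurableSet_range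
      inter_subset_left fun y hy => ?_
    rw [hφU y fun h => hy.2 ⟨hy.1, h⟩, zero_mul]
  rw [h1, frontier_inter_eq_graph_inter hg.continuous hU hA, ← h2, ← map_graphChart hg,
    hemb.integral_map, integral_withDensity_eq_integral_toReal_smul
      (((measurable_fderiv ℝ g).norm.pow_const 2).const_add 1).sqrt.ennreal_ofReal
      (Eventually.of_forall fun _ => ENNReal.ofReal_lt_top)]
  refine integral_congr_ae ?_
  filter_upwards [ae_outerNormal_graphChart hg hU hA] with x hx
  by_cases hxU : graphChart T g x ∈ U
  · have hq := one_le_norm_upwardNormal (T := T) (fderiv ℝ g x)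
    rw [hx hxU, ENNReal.toReal_ofReal (Real.sqrt_nonneg _), ← norm_upwardNormal (T := T),
      inner_smul_right, smul_eq_mul]
    field_simp
  · simp [hφU _ hxU]

/-- Inside `U`, the set `A` differs from the closed subgraph only on the graph, which has volume
zero. -/
theorem setIntegral_fderiv_chart {A U : Set E3} (hAm : NullMeasurableSet A)
    (hg : LipschitzWith K g) (hU : IsOpen U)
    (hA : ∀ X ∈ U, ((T X).snd < g (T X).fst → X ∈ A) ∧ (g (T X).fst < (T X).snd → X ∉ A))
    {φ : E3 → ℝ} (hφ : ContDiff ℝ 1 φ) (hc : HasCompactSupport φ) (hφU : tsupport φ ⊆ U) (v : E3) :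
    ∫ X in A, fderiv ℝ φ X v = ∫ y in frontier A, φ y * ⟪v, outerNormal A y⟫ ∂μHE[2] := by
  have hfst := continuous_fst_apply T
  have hsnd := continuous_snd_apply T
  have hbelow : MeasurableSet {X : E3 | (T X).snd ≤ g (T X).fst} :=
    (isClosed_le hsnd (hg.continuous.comp hfst)).measurableSet
  rw [setIntegral_frontier_chart hg hU hA
      (fun X hX => image_eq_zero_of_notMem_tsupport fun h => hX (hφU h)) v,
    ← setIntegral_fderiv_below_graphChart hφ hc hg v, ← integral_indicator₀ hAm,
    ← integral_indicator hbelow]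
  refine integral_congr_ae ?_
  filter_upwards [compl_mem_ae_iff.2 (volume_range_graphChart (T := T) hg.continuous)] with X hX
  rw [mem_compl_iff, mem_range_graphChart_iff] at hX
  by_cases hXU : X ∈ U
  · rcases lt_or_gt_of_ne hX with h | h
    · rw [indicator_of_mem ((hA X hXU).1 h), indicator_of_mem (show X ∈ {X : E3 | (T X).snd ≤ g (T X).fst} from h.le)]
    · have h' : X ∉ {X : E3 | (T X).snd ≤ g (T X).fst} := h.not_ge
      rw [indicator_of_notMem ((hA X hXU).2 h), indicator_of_notMem h']
  · have h0 : fderiv ℝ φ X = 0 := fderiv_of_notMem_tsupport ℝ fun h => hXU (hφU h)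
    simp [indicator, h0]

end Chart

/-- The divergence theorem for functions supported near a Lipschitz boundary point. -/
theorem IsLipschitzBoundaryPoint.exists_divergence_nhds {A : Set E3} {p : E3}
    (hp : IsLipschitzBoundaryPoint A p) (hAm : NullMeasurableSet A) :
    ∃ U : Set E3, IsOpen U ∧ p ∈ U ∧
      AEStronglyMeasurable (outerNormal A) ((μHE[2] : Measure E3).restrict (frontier A ∩ U)) ∧
      ∀ φ : E3 → ℝ, ContDiff ℝ 1 φ → HasCompactSupport φ → tsupport φ ⊆ U → ∀ v : E3,
        ∫ X in A, fderiv ℝ φ X v = ∫ y in frontier A, φ y * ⟪v, outerNormal A y⟫ ∂μHE[2] := by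
  obtain ⟨T, K, g, hg, hA⟩ := hp
  obtain ⟨U, hUA, hU, hpU⟩ := eventually_nhds_iff.1 hA
  exact ⟨U, hU, hpU, aestronglyMeasurable_outerNormal_chart hg hU hUA,
    fun φ hφ hc hφU v => setIntegral_fderiv_chart hAm hg hU hUA hφ hc hφU v⟩

/-! ### Cutting off sets of surface area zero -/

section Cutoff

open scoped ENNReal

/-- A compact set of two-dimensional Hausdorff measure zero is covered by finitely many balls
with small sum of the squared radii. -/
theorem exists_finset_cover_sum_sq_lt {X : Type*} [MetricSpace X] [MeasurableSpace X]
    [BorelSpace X] [Nonempty X] {k : Set X} (hk : IsCompact k) (h0 : μHE[2] k = 0) {ε : ℝ} (hε : 0 < ε) :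
    ∃ (s : Finset ℕ) (c : ℕ → X) (r : ℕ → ℝ), (∀ n ∈ s, c n ∈ k ∧ 0 < r n) ∧
      k ⊆ ⋃ n ∈ s, Metric.ball (c n) (r n) ∧ ∑ n ∈ s, r n ^ 2 < ε := by
  have hH : μH[2] k = 0 := by
    rw [Measure.euclideanHausdorffMeasure_def, Measure.smul_apply, ENNReal.smul_def, smul_eq_mul,
      mul_eq_zero] at h0
    refine (h0.resolve_left ?_)
    exact_mod_cast Measure.addHaarScalarFactor_volume_hausdorffMeasure_ne_zero 2
  have hε2 : (0 : ℝ≥0∞) < ENNReal.ofReal (ε / 2) := ENNReal.ofReal_pos.2 (by linarith)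
  rw [Measure.hausdorffMeasure_apply] at hH
  -- Hausdorff measure is a supremum over mesh sizes; mesh one suffices and keeps all diameters
  -- finite.
  have h1 : (⨅ (t : ℕ → Set X) (_ : k ⊆ ⋃ n, t n) (_ : ∀ n, Metric.ediam (t n) ≤ 1),
      ∑' n, ⨆ _ : (t n).Nonempty, Metric.ediam (t n) ^ (2 : ℝ)) < ENNReal.ofReal (ε / 2) := by
    refine lt_of_le_of_lt ?_ hε2
    rw [← hH]
    exact le_iSup₂_of_le 1 one_pos le_rfl
  simp only [iInf_lt_iff] at h1
  obtain ⟨t, htk, htd, hts⟩ := h1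
  obtain ⟨δ, hδ0, hδ⟩ := ENNReal.exists_pos_sum_of_countable hε2.ne' ℕ
  have htfin : ∀ n, Metric.ediam (t n) ≠ ⊤ := fun n => ((htd n).trans_lt ENNReal.one_lt_top).ne
  -- The added `δ n` makes the radius exceed the diameter even for singletons, so a ball centred in
  -- `t n ∩ k` contains `t n`. All of them together add less than `ε / 2` to the sum of squares.
  set r : ℕ → ℝ := fun n => √(Metric.diam (t n) ^ 2 + δ n) with hr
  have hr0 : ∀ n, 0 < r n := fun n => Real.sqrt_pos.2 (by have := hδ0 n; positivity)
  have hdr : ∀ n, Metric.diam (t n) < r n := fun n =>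
    Real.lt_sqrt_of_sq_lt (by have := hδ0 n; simpa using this)
  classical
  set c : ℕ → X := fun n => if h : (t n ∩ k).Nonempty then h.some else Classical.arbitrary X
    with hc
  have hcn : ∀ n, (t n ∩ k).Nonempty → c n ∈ t n ∩ k := fun n h => by
    rw [hc]
    simp only [dif_pos h]
    exact h.some_mem
  have hcover : k ⊆ ⋃ n ∈ {n | (t n ∩ k).Nonempty}, Metric.ball (c n) (r n) := by
    intro x hx
    obtain ⟨n, hn⟩ := mem_iUnion.1 (htk hx)
    have hne : (t n ∩ k).Nonempty := ⟨x, hn, hx⟩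
    refine mem_iUnion₂.2 ⟨n, hne, ?_⟩
    exact (Metric.dist_le_diam_of_mem' (htfin n) hn (hcn n hne).1).trans_lt (hdr n)
  obtain ⟨s', hs', hs'fin, hs'k⟩ := hk.elim_finite_subcover_image
    (fun n _ => Metric.isOpen_ball) hcover
  have hmem : ∀ n ∈ hs'fin.toFinset, (t n ∩ k).Nonempty := fun n hn =>
    hs' (hs'fin.mem_toFinset.1 hn)
  have hne : ∀ n ∈ hs'fin.toFinset, (t n).Nonempty := fun n hn =>
    (hmem n hn).mono inter_subset_left
  refine ⟨hs'fin.toFinset, c, r, fun n hn => ⟨(hcn n (hmem n hn)).2, hr0 n⟩,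
    by simpa using hs'k, ?_⟩
  have hsum : ENNReal.ofReal (∑ n ∈ hs'fin.toFinset, r n ^ 2) < ENNReal.ofReal ε := by
    calc ENNReal.ofReal (∑ n ∈ hs'fin.toFinset, r n ^ 2)
        = ∑ n ∈ hs'fin.toFinset, (Metric.ediam (t n) ^ (2 : ℝ) + δ n) := by
          rw [ENNReal.ofReal_sum_of_nonneg fun n _ => by positivity]
          refine Finset.sum_congr rfl fun n _ => ?_
          rw [hr, Real.sq_sqrt (by positivity), ENNReal.ofReal_add (by positivity) (by positivity),
            ENNReal.ofReal_coe_nnreal, ENNReal.ofReal_pow Metric.diam_nonneg, Metric.diam,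
            ENNReal.ofReal_toReal (htfin n), ← ENNReal.rpow_natCast]
          norm_num
      _ = ∑ n ∈ hs'fin.toFinset, (⨆ _ : (t n).Nonempty, Metric.ediam (t n) ^ (2 : ℝ)) +
            ∑ n ∈ hs'fin.toFinset, (δ n : ℝ≥0∞) := by
          rw [Finset.sum_add_distrib]
          congr 1
          exact Finset.sum_congr rfl fun n hn => by simp [hne n hn]
      _ ≤ ∑' n, (⨆ _ : (t n).Nonempty, Metric.ediam (t n) ^ (2 : ℝ)) + ∑' n, (δ n : ℝ≥0∞) :=
          add_le_add (ENNReal.sum_le_tsum _) (ENNReal.sum_le_tsum _)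
      _ < ENNReal.ofReal (ε / 2) + ENNReal.ofReal (ε / 2) := ENNReal.add_lt_add hts hδ
      _ = ENNReal.ofReal ε := by
          rw [← ENNReal.ofReal_add (by linarith) (by linarith), add_halves]
  exact (ENNReal.ofReal_lt_ofReal_iff hε).1 hsum

/-- The rescaled bump function on the ball with center `c` and radius `2 r`. -/
noncomputable def scaledBump (c : E3) (r : ℝ) (x : E3) : ℝ :=
  (⟨1, 2, one_pos, one_lt_two⟩ : ContDiffBump (0 : E3)) (r⁻¹ • (x - c))

/-- The total variation of the unscaled bump function. -/
noncomputable def bumpVariation : ℝ :=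
  ∫ x : E3, ‖fderiv ℝ (scaledBump 0 1) x‖

theorem contDiff_scaledBump (c : E3) (r : ℝ) : ContDiff ℝ ∞ (scaledBump c r) :=
  (ContDiffBump.contDiff _).comp ((contDiff_id.sub contDiff_const).const_smul _)

theorem scaledBump_mem_Icc (c : E3) (r : ℝ) (x : E3) : scaledBump c r x ∈ Icc (0 : ℝ) 1 :=
  ⟨ContDiffBump.nonneg _, ContDiffBump.le_one _⟩

theorem scaledBump_eq_one {c : E3} {r : ℝ} (hr : 0 < r) {x : E3} (hx : x ∈ Metric.ball c r) :
    scaledBump c r x = 1 := by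
  refine ContDiffBump.one_of_mem_closedBall _ ?_
  rw [Metric.mem_ball, dist_eq_norm] at hx
  rw [mem_closedBall_zero_iff, norm_smul, norm_inv, Real.norm_of_nonneg hr.le]
  exact (inv_mul_le_iff₀ hr).2 (by linarith)

theorem scaledBump_eq_zero {c : E3} {r : ℝ} (hr : 0 < r) {x : E3} (hx : 2 * r ≤ dist x c) :
    scaledBump c r x = 0 := by
  refine ContDiffBump.zero_of_le_dist _ ?_
  rw [dist_eq_norm] at hx
  rw [dist_zero_right, norm_smul, norm_inv, Real.norm_of_nonneg hr.le, le_inv_mul_iff₀ hr]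
  linarith

theorem hasCompactSupport_scaledBump {c : E3} {r : ℝ} (hr : 0 < r) :
    HasCompactSupport (scaledBump c r) := by
  refine HasCompactSupport.intro (isCompact_closedBall c (2 * r)) fun x hx => ?_
  rw [Metric.mem_closedBall, not_le] at hx
  exact scaledBump_eq_zero hr hx.le

theorem integrable_norm_fderiv_scaledBump {c : E3} {r : ℝ} (hr : 0 < r) :
    Integrable fun x => ‖fderiv ℝ (scaledBump c r) x‖ :=
  (((contDiff_scaledBump c r).continuous_fderiv (by simp)).integrable_of_hasCompactSupport
    ((hasCompactSupport_scaledBump hr).fderiv ℝ)).norm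

/-- The gradient scales like `r⁻¹` and volume like `r³`. The resulting `r²` is what makes sets of
zero two-dimensional measure removable. -/
theorem integral_norm_fderiv_scaledBump {c : E3} {r : ℝ} (hr : 0 < r) :
    ∫ x, ‖fderiv ℝ (scaledBump c r) x‖ = r ^ 2 * bumpVariation := by
  have h1 : ∀ x, ‖fderiv ℝ (scaledBump c r) x‖ =
      r⁻¹ * ‖fderiv ℝ (scaledBump 0 1) (r⁻¹ • (x - c))‖ := by
    intro x
    have : scaledBump c r = fun y => scaledBump 0 1 (r⁻¹ • (y - c)) := by
      funext y; simp [scaledBump]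
    have hd : HasFDerivAt (fun y : E3 => r⁻¹ • (y - c)) (r⁻¹ • ContinuousLinearMap.id ℝ E3) x :=
      ((hasFDerivAt_id x).sub_const c).const_smul r⁻¹
    have hd2 := (((contDiff_scaledBump 0 1).differentiable (by simp)
      (r⁻¹ • (x - c))).hasFDerivAt.comp x hd).fderiv
    rw [this]
    change ‖fderiv ℝ (scaledBump 0 1 ∘ fun y => r⁻¹ • (y - c)) x‖ = _
    rw [hd2, ContinuousLinearMap.comp_smul, ContinuousLinearMap.comp_id, norm_smul, norm_inv,
      Real.norm_of_nonneg hr.le]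
  simp only [h1, integral_const_mul]
  rw [integral_sub_right_eq_self (fun x => ‖fderiv ℝ (scaledBump 0 1) (r⁻¹ • x)‖) c,
    Measure.integral_comp_inv_smul volume (fun x => ‖fderiv ℝ (scaledBump 0 1) x‖) r,
    finrank_euclideanSpace, Fintype.card_fin, abs_of_pos (by positivity), smul_eq_mul, bumpVariation]
  field_simp

/-- In the product rule all undifferentiated factors lie in `[0, 1]` and can be dropped. -/
theorem norm_fderiv_prod_one_sub_le (s : Finset ℕ) (c : ℕ → E3) (r : ℕ → ℝ) (x : E3) :
    ‖fderiv ℝ (fun x => ∏ n ∈ s, (1 - scaledBump (c n) (r n) x)) x‖ ≤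
      ∑ n ∈ s, ‖fderiv ℝ (scaledBump (c n) (r n)) x‖ := by
  have hd : ∀ n, DifferentiableAt ℝ (scaledBump (c n) (r n)) x := fun n =>
    (contDiff_scaledBump _ _).differentiable (by simp) x
  rw [fderiv_finsetProd (g := fun n x => 1 - scaledBump (c n) (r n) x)
    fun n _ => (hd n).const_sub 1]
  refine (norm_sum_le _ _).trans (Finset.sum_le_sum fun n _ => ?_)
  rw [fderiv_const_sub, norm_smul, norm_neg]
  refine mul_le_of_le_one_left (norm_nonneg _) ?_
  rw [norm_prod]
  refine Finset.prod_le_one (fun _ _ => norm_nonneg _) fun m _ => ?_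
  have := scaledBump_mem_Icc (c m) (r m) x
  rw [Real.norm_of_nonneg (by linarith [this.2])]
  linarith [this.1]

/-- Cutoff functions near a compact set of surface area zero, with small total variation. -/
theorem exists_cutoff {k : Set E3} (hk : IsCompact k) (h0 : μHE[2] k = 0) {ε : ℝ} (hε : 0 < ε) :
    ∃ φ : E3 → ℝ, ContDiff ℝ ∞ φ ∧ (∀ x, φ x ∈ Icc (0 : ℝ) 1) ∧ tsupport φ ⊆ kᶜ ∧
      (∀ x, (∀ y ∈ k, ε ≤ dist x y) → φ x = 1) ∧
      Integrable (fun x => ‖fderiv ℝ φ x‖) ∧ ∫ x, ‖fderiv ℝ φ x‖ ≤ ε := by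
  have hV : 0 ≤ bumpVariation := integral_nonneg fun _ => norm_nonneg _
  -- The first bound forces every radius below `ε / 2`, so the bumps, which reach out to `2 r`, stay
  -- within `ε` of `k`. The second controls the total variation; the `+ 1` avoids division by zero.
  set ε' := min ((ε / 2) ^ 2) (ε / (bumpVariation + 1))
  have hε'0 : 0 < ε' := lt_min (by positivity) (by positivity)
  obtain ⟨s, c, r, hcr, hcov, hsum⟩ := exists_finset_cover_sum_sq_lt hk h0 hε'0
  have hcd : ContDiff ℝ ∞ fun x => ∏ n ∈ s, (1 - scaledBump (c n) (r n) x) :=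
    contDiff_prod fun n _ => contDiff_const.sub (contDiff_scaledBump _ _)
  have hmem : ∀ n x, 1 - scaledBump (c n) (r n) x ∈ Icc (0 : ℝ) 1 := fun n x => by
    have := scaledBump_mem_Icc (c n) (r n) x
    exact ⟨by linarith [this.2], by linarith [this.1]⟩
  have hint : Integrable fun x => ∑ n ∈ s, ‖fderiv ℝ (scaledBump (c n) (r n)) x‖ :=
    integrable_finsetSum _ fun n hn => integrable_norm_fderiv_scaledBump (hcr n hn).2
  have hi : Integrable fun x => ‖fderiv ℝ (fun x => ∏ n ∈ s, (1 - scaledBump (c n) (r n) x)) x‖ :=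
    hint.mono' (hcd.continuous_fderiv (by simp)).norm.aestronglyMeasurable
      (Eventually.of_forall fun x => by
        rw [norm_norm]; exact norm_fderiv_prod_one_sub_le s c r x)
  refine ⟨_, hcd, fun x => ⟨Finset.prod_nonneg fun n _ => (hmem n x).1,
    Finset.prod_le_one (fun n _ => (hmem n x).1) fun n _ => (hmem n x).2⟩, ?_, fun x hx => ?_,
    hi, ?_⟩
  · intro x hx hxk
    refine (notMem_tsupport_iff_eventuallyEq.2 ?_) hx
    obtain ⟨n, hn, hxn⟩ := mem_iUnion₂.1 (hcov hxk)
    filter_upwards [Metric.isOpen_ball.mem_nhds hxn] with y hy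
    refine Finset.prod_eq_zero hn ?_
    rw [scaledBump_eq_one (hcr n hn).2 hy, sub_self]
  · refine Finset.prod_eq_one fun n hn => ?_
    have h1 : r n ^ 2 < (ε / 2) ^ 2 :=
      ((Finset.single_le_sum (f := fun n => r n ^ 2) (fun _ _ => sq_nonneg _) hn).trans_lt
        hsum).trans_le (min_le_left _ _)
    have h2 := lt_of_pow_lt_pow_left₀ 2 (by positivity) h1
    rw [scaledBump_eq_zero (hcr n hn).2 (by linarith [hx _ (hcr n hn).1]), sub_zero]
  · calc ∫ x, ‖fderiv ℝ (fun x => ∏ n ∈ s, (1 - scaledBump (c n) (r n) x)) x‖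
        ≤ ∫ x, ∑ n ∈ s, ‖fderiv ℝ (scaledBump (c n) (r n)) x‖ :=
          integral_mono hi hint fun x => norm_fderiv_prod_one_sub_le s c r x
      _ = (∑ n ∈ s, r n ^ 2) * bumpVariation := by
          rw [integral_finsetSum _ fun n hn => integrable_norm_fderiv_scaledBump (hcr n hn).2,
            Finset.sum_mul]
          exact Finset.sum_congr rfl fun n hn => integral_norm_fderiv_scaledBump (hcr n hn).2
      _ ≤ ε / (bumpVariation + 1) * (bumpVariation + 1) := by
          gcongr
          · exact hsum.le.trans (min_le_right _ _)
          · linarith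
      _ = ε := div_mul_cancel₀ _ (by positivity)

end Cutoff

/-! ### The divergence theorem on piecewise Lipschitz regions -/

section Divergence

open scoped Manifold

theorem volume_eq_zero_of_surface_lt_top {s : Set E3} (h : μHE[2] s < ⊤) : volume s = 0 := by
  rw [← EuclideanSpace.euclideanHausdorffMeasure_eq_volume 3]
  exact (Measure.euclideanHausdorffMeasure_zero_or_top (by norm_num : 2 < 3) s).resolve_right h.ne

theorem HasPiecewiseLipschitzBoundary.nullMeasurableSet {A : Set E3}
    (hA : HasPiecewiseLipschitzBoundary A) : NullMeasurableSet A :=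
  nullMeasurableSet_of_null_frontier (volume_eq_zero_of_surface_lt_top hA.1)

/-- By the Lindelöf property countably many charts cover the frontier off `N`, and `N` has area
zero. -/
theorem HasPiecewiseLipschitzBoundary.aestronglyMeasurable_outerNormal {A : Set E3}
    (hA : HasPiecewiseLipschitzBoundary A) :
    AEStronglyMeasurable (outerNormal A) ((μHE[2] : Measure E3).restrict (frontier A)) := by
  obtain ⟨-, N, hNc, hN0, hN⟩ := id hA
  choose! U hUo hpU hUm _ using fun p hp =>
    (hN p hp).exists_divergence_nhds hA.nullMeasurableSet
  obtain ⟨t, hts, htc, htcov⟩ := TopologicalSpace.countable_cover_nhdsWithin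
    (s := frontier A \ N) (f := U) fun p hp =>
      mem_nhdsWithin_of_mem_nhds ((hUo p hp).mem_nhds (hpU p hp))
  have : Countable t := htc.to_subtype
  have h1 : AEStronglyMeasurable (outerNormal A)
      ((μHE[2] : Measure E3).restrict (⋃ p : t, frontier A ∩ U p)) :=
    aestronglyMeasurable_iUnion_iff.2 fun p => hUm p (hts p.2)
  have h2 : (μHE[2] : Measure E3).restrict (frontier A) =
      (μHE[2] : Measure E3).restrict (frontier A \ N) :=
    (Measure.restrict_congr_set (sdiff_null_ae_eq_self hN0)).symm
  rw [h2]
  refine h1.mono_set fun y hy => ?_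
  obtain ⟨p, hp, hyp⟩ := mem_iUnion₂.1 (htcov hy)
  exact mem_iUnion.2 ⟨⟨p, hp⟩, hy.1, hyp⟩

/-- The flux of a continuous field through a piecewise Lipschitz boundary is integrable. -/
theorem HasPiecewiseLipschitzBoundary.integrableOn_inner_outerNormal {A : Set E3}
    (hA : HasPiecewiseLipschitzBoundary A) (hb : Bornology.IsBounded A) {F : E3 → E3}
    (hF : ContinuousOn F (frontier A)) :
    IntegrableOn (fun y => ⟪F y, outerNormal A y⟫) (frontier A) μHE[2] := by
  have hcomp : IsCompact (frontier A) :=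
    Metric.isCompact_of_isClosed_isBounded isClosed_frontier
      (hb.closure.subset frontier_subset_closure)
  obtain ⟨C, hC⟩ := hcomp.exists_bound_of_continuousOn hF
  have hm : AEStronglyMeasurable F ((μHE[2] : Measure E3).restrict (frontier A)) :=
    hF.aestronglyMeasurable isClosed_frontier.measurableSet
  have : IsFiniteMeasure ((μHE[2] : Measure E3).restrict (frontier A)) :=
    ⟨by rw [Measure.restrict_apply_univ]; exact hA.1⟩
  refine Integrable.of_bound (hm.inner hA.aestronglyMeasurable_outerNormal) C ?_
  filter_upwards [ae_restrict_mem isClosed_frontier.measurableSet] with y hy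
  calc ‖⟪F y, outerNormal A y⟫‖ ≤ ‖F y‖ * ‖outerNormal A y‖ := norm_inner_le_norm _ _
    _ ≤ C * 1 := mul_le_mul (hC y hy) (norm_outerNormal_le A y) (norm_nonneg _)
        ((norm_nonneg _).trans (hC y hy))
    _ = C := mul_one C

theorem HasPiecewiseLipschitzBoundary.integrableOn_mul_inner_outerNormal {A : Set E3}
    (hA : HasPiecewiseLipschitzBoundary A) (hb : Bornology.IsBounded A) {φ : E3 → ℝ}
    (hφ : Continuous φ) (v : E3) :
    IntegrableOn (fun y => φ y * ⟪v, outerNormal A y⟫) (frontier A) μHE[2] := by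
  have := hA.integrableOn_inner_outerNormal hb (F := fun y => φ y • v)
    (hφ.smul continuous_const).continuousOn
  simpa only [inner_smul_left, conj_trivial] using this

theorem integral_fderiv_eq_zero {φ : E3 → ℝ} (hφ : ContDiff ℝ 1 φ) (hc : HasCompactSupport φ)
    (v : E3) : ∫ x, fderiv ℝ φ x v = 0 := by
  obtain ⟨C, hC⟩ := hφ.lipschitzWith_of_hasCompactSupport hc one_ne_zero
  rw [← integral_lineDeriv_eq_zero hC hc v]
  refine integral_congr_ae (Eventually.of_forall fun x => ?_)
  exact ((hφ.differentiable one_ne_zero x).lineDeriv_eq_fderiv).symm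

/-- The divergence theorem away from the boundary. -/
theorem exists_divergence_nhds_of_notMem_frontier {A : Set E3} {p : E3}
    (hp : p ∉ frontier A) :
    ∃ U : Set E3, IsOpen U ∧ p ∈ U ∧
      ∀ φ : E3 → ℝ, ContDiff ℝ 1 φ → HasCompactSupport φ → tsupport φ ⊆ U → ∀ v : E3,
        ∫ X in A, fderiv ℝ φ X v = ∫ y in frontier A, φ y * ⟪v, outerNormal A y⟫ ∂μHE[2] := by
  have hzero : ∀ φ : E3 → ℝ, (∀ y ∈ frontier A, φ y = 0) → ∀ v : E3,
      ∫ y in frontier A, φ y * ⟪v, outerNormal A y⟫ ∂μHE[2] = 0 := fun φ h v => by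
    refine setIntegral_eq_zero_of_forall_eq_zero fun y hy => ?_
    rw [h y hy, zero_mul]
  have hder : ∀ φ : E3 → ℝ, ∀ X ∉ tsupport φ, ∀ v, fderiv ℝ φ X v = 0 := fun φ X hX v => by
    rw [fderiv_of_notMem_tsupport ℝ hX, zero_apply]
  by_cases hpi : p ∈ interior A
  · refine ⟨interior A, isOpen_interior, hpi, fun φ hφ hc hφA v => ?_⟩
    rw [hzero φ fun y hy => image_eq_zero_of_notMem_tsupport fun h => hy.2 (hφA h),
      setIntegral_eq_integral_of_forall_compl_eq_zero fun X hX =>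
        hder φ X (fun h => hX (interior_subset (hφA h))) v]
    exact integral_fderiv_eq_zero hφ hc v
  · have hpc : p ∈ (closure A)ᶜ := fun h => hp ⟨h, hpi⟩
    refine ⟨(closure A)ᶜ, isClosed_closure.isOpen_compl, hpc, fun φ hφ hc hφA v => ?_⟩
    rw [hzero φ fun y hy => image_eq_zero_of_notMem_tsupport fun h => hφA h hy.1]
    exact setIntegral_eq_zero_of_forall_eq_zero fun X hX =>
      hder φ X (fun h => hφA h (subset_closure hX)) v

/-- The divergence theorem for functions supported away from a closed set outside of which all
boundary points are Lipschitz. -/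
theorem setIntegral_fderiv_of_tsupport_subset {A N : Set E3}
    (hA : HasPiecewiseLipschitzBoundary A) (hb : Bornology.IsBounded A)
    (hN : ∀ p ∈ frontier A \ N, IsLipschitzBoundaryPoint A p)
    {ψ : E3 → ℝ} (hψ : ContDiff ℝ 1 ψ) (hc : HasCompactSupport ψ)
    (hψN : tsupport ψ ⊆ (N ∩ frontier A)ᶜ) (v : E3) :
    ∫ X in A, fderiv ℝ ψ X v = ∫ y in frontier A, ψ y * ⟪v, outerNormal A y⟫ ∂μHE[2] := by
  have hloc : ∀ p ∈ tsupport ψ, ∃ U : Set E3, IsOpen U ∧ p ∈ U ∧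
      ∀ φ : E3 → ℝ, ContDiff ℝ 1 φ → HasCompactSupport φ → tsupport φ ⊆ U → ∀ v : E3,
        ∫ X in A, fderiv ℝ φ X v = ∫ y in frontier A, φ y * ⟪v, outerNormal A y⟫ ∂μHE[2] := by
    intro p hp
    by_cases hpA : p ∈ frontier A
    · obtain ⟨U, h1, h2, -, h3⟩ := (hN p ⟨hpA, fun h => hψN hp ⟨h, hpA⟩⟩).exists_divergence_nhds
        hA.nullMeasurableSet
      exact ⟨U, h1, h2, h3⟩
    · exact exists_divergence_nhds_of_notMem_frontier hpA
  choose! U hUo hpU hU using hloc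
  obtain ⟨t, htψ, htcov⟩ := hc.isCompact.elim_nhds_subcover U fun p hp =>
    (hUo p hp).mem_nhds (hpU p hp)
  -- Both sides are linear in `ψ`, so it suffices to treat the finitely many pieces `ρ i * ψ`, each
  -- supported where the local theorem holds.
  obtain ⟨ρ, hρ⟩ := SmoothPartitionOfUnity.exists_isSubordinate 𝓘(ℝ, E3) (isClosed_tsupport ψ)
    (fun i : t => U i) (fun i => hUo i (htψ i i.2))
    (by simpa [iUnion_subtype] using htcov)
  have hρd : ∀ i, ContDiff ℝ 1 (ρ i) := fun i =>
    ((ρ i).contMDiff.contDiff).of_le (by exact_mod_cast le_top)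
  have hsum : ∀ x, ψ x = ∑ i : t, ρ i x * ψ x := by
    intro x
    by_cases hx : x ∈ tsupport ψ
    · have := ρ.sum_eq_one hx
      rw [finsum_eq_sum_of_fintype] at this
      rw [← Finset.sum_mul, this, one_mul]
    · simp [image_eq_zero_of_notMem_tsupport hx]
  have hid : ∀ i : t, ContDiff ℝ 1 fun x => ρ i x * ψ x := fun i => (hρd i).mul hψ
  have hic : ∀ i : t, HasCompactSupport fun x => ρ i x * ψ x := fun i => hc.mul_left
  have hfd : ∀ X, fderiv ℝ ψ X v = ∑ i : t, fderiv ℝ (fun x => ρ i x * ψ x) X v := by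
    intro X
    conv_lhs => rw [show ψ = fun x => ∑ i : t, ρ i x * ψ x from funext hsum]
    rw [fderiv_fun_sum fun i _ => (hid i).differentiable one_ne_zero X, sum_apply]
  have hbd : ∀ y, ψ y * ⟪v, outerNormal A y⟫ =
      ∑ i : t, ρ i y * ψ y * ⟪v, outerNormal A y⟫ := by
    intro y
    rw [← Finset.sum_mul, ← hsum]
  simp only [hfd, hbd]
  rw [integral_finsetSum, integral_finsetSum]
  · refine Finset.sum_congr rfl fun i _ => hU i (htψ i i.2) _ (hid i) (hic i) ?_ v
    exact (tsupport_mul_subset_left).trans (hρ i)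
  · exact fun i _ => hA.integrableOn_mul_inner_outerNormal hb (hid i).continuous v
  · exact fun i _ => ((((hid i).continuous_fderiv one_ne_zero).clm_apply
      continuous_const).integrable_of_hasCompactSupport
        (((hic i).fderiv ℝ).comp_left (g := fun L : E3 →L[ℝ] ℝ => L v) rfl)).integrableOn

/-- The **divergence theorem** on bounded piecewise Lipschitz regions, for compactly supported
functions. -/
theorem HasPiecewiseLipschitzBoundary.setIntegral_fderiv_of_hasCompactSupport {A : Set E3}
    (hA : HasPiecewiseLipschitzBoundary A) (hb : Bornology.IsBounded A)
    {f : E3 → ℝ} (hf : ContDiff ℝ 1 f) (hc : HasCompactSupport f) (v : E3) :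
    ∫ X in A, fderiv ℝ f X v = ∫ y in frontier A, f y * ⟪v, outerNormal A y⟫ ∂μHE[2] := by
  obtain ⟨-, N, hNc, hN0, hN⟩ := id hA
  set k := N ∩ frontier A
  have hk : IsCompact k := Metric.isCompact_of_isClosed_isBounded (hNc.inter isClosed_frontier)
    (hb.closure.subset (inter_subset_right.trans frontier_subset_closure))
  have hk0 : μHE[2] k = 0 := measure_mono_null inter_subset_left hN0
  have hkv : volume k = 0 := volume_eq_zero_of_surface_lt_top (by simp [hk0])
  choose φ hφd hφm hφk hφ1 hφi hφv using fun n : ℕ =>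
    exists_cutoff hk hk0 (ε := 1 / ((n : ℝ) + 1)) (by positivity)
  -- Since `k` is null for both volume and surface measure, this pointwise statement feeds dominated
  -- convergence on both sides.
  have hlim : ∀ x ∉ k, ∀ᶠ n in atTop, φ n x = 1 := by
    intro x hx
    obtain ⟨δ, hδ, hδk⟩ := Metric.isOpen_iff.1 hk.isClosed.isOpen_compl x hx
    filter_upwards [(tendsto_one_div_add_atTop_nhds_zero_nat (𝕜 := ℝ)).eventually_lt_const hδ]
      with n hn
    refine hφ1 n x fun y hy => ?_
    by_contra hlt
    refine hδk (show y ∈ Metric.ball x δ from ?_) hy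
    rw [Metric.mem_ball, dist_comm]
    linarith
  have hφ1' : ∀ n, ContDiff ℝ 1 (φ n) := fun n => (hφd n).of_le (by exact_mod_cast le_top)
  have hφb : ∀ n x, ‖φ n x‖ ≤ 1 := fun n x => by
    rw [Real.norm_of_nonneg (hφm n x).1]; exact (hφm n x).2
  have hfi : Integrable fun x => fderiv ℝ f x v :=
    ((hf.continuous_fderiv one_ne_zero).clm_apply
      continuous_const).integrable_of_hasCompactSupport
        ((hc.fderiv ℝ).comp_left (g := fun L : E3 →L[ℝ] ℝ => L v) rfl)
  obtain ⟨C, hC⟩ := hf.continuous.bounded_above_of_compact_support hc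
  have hC0 : 0 ≤ C := (norm_nonneg _).trans (hC 0)
  have hterm : ∀ n x, ‖f x * fderiv ℝ (φ n) x v‖ ≤ C * ‖v‖ * ‖fderiv ℝ (φ n) x‖ := fun n x => by
    rw [norm_mul]
    calc ‖f x‖ * ‖fderiv ℝ (φ n) x v‖ ≤ C * (‖fderiv ℝ (φ n) x‖ * ‖v‖) := by
          gcongr
          · exact hC x
          · exact ContinuousLinearMap.le_opNorm _ _
      _ = _ := by ring
  have hti : ∀ n, Integrable fun x => f x * fderiv ℝ (φ n) x v := fun n =>
    ((hφi n).const_mul (C * ‖v‖)).mono' (hf.continuous.mul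
      (((hφ1' n).continuous_fderiv one_ne_zero).clm_apply continuous_const)).aestronglyMeasurable
        (Eventually.of_forall (hterm n))
  have hpi : ∀ n, Integrable fun x => φ n x * fderiv ℝ f x v := fun n =>
    hfi.bdd_mul (c := 1) (hφ1' n).continuous.aestronglyMeasurable (Eventually.of_forall (hφb n))
  have hsplit : ∀ n, ∫ X in A, fderiv ℝ (fun x => φ n x * f x) X v =
      (∫ X in A, φ n X * fderiv ℝ f X v) + ∫ X in A, f X * fderiv ℝ (φ n) X v := fun n => by
    rw [← integral_add (hpi n).integrableOn (hti n).integrableOn]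
    refine integral_congr_ae (Eventually.of_forall fun X => ?_)
    dsimp only
    rw [fderiv_fun_mul ((hφ1' n).differentiable one_ne_zero X) (hf.differentiable one_ne_zero X)]
    simp
  have hdiv : ∀ n, ∫ X in A, fderiv ℝ (fun x => φ n x * f x) X v =
      ∫ y in frontier A, φ n y * f y * ⟪v, outerNormal A y⟫ ∂μHE[2] := fun n =>
    setIntegral_fderiv_of_tsupport_subset hA hb hN ((hφ1' n).mul hf) hc.mul_left
      (tsupport_mul_subset_left.trans (hφk n)) v
  have hL1 : Tendsto (fun n => ∫ X in A, φ n X * fderiv ℝ f X v) atTop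
      (𝓝 (∫ X in A, fderiv ℝ f X v)) := by
    refine tendsto_integral_of_dominated_convergence (fun X => ‖fderiv ℝ f X v‖)
      (fun n => (hpi n).integrableOn.aestronglyMeasurable) hfi.norm.integrableOn
      (fun n => Eventually.of_forall fun X => ?_) ?_
    · rw [norm_mul]
      exact mul_le_of_le_one_left (norm_nonneg _) (hφb n X)
    · filter_upwards [ae_restrict_of_ae (compl_mem_ae_iff.2 hkv)] with X hX
      refine tendsto_const_nhds.congr' ?_
      filter_upwards [hlim X hX] with n hn
      rw [hn, one_mul]
  -- The product-rule error is at most `C * ‖v‖` times the total variation of the cutoff, which is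
  -- at most `1 / (n + 1)`.
  have hL2 : Tendsto (fun n => ∫ X in A, f X * fderiv ℝ (φ n) X v) atTop (𝓝 0) := by
    refine squeeze_zero_norm (a := fun n : ℕ => C * ‖v‖ * (1 / ((n : ℝ) + 1))) (fun n => ?_) ?_
    · calc ‖∫ X in A, f X * fderiv ℝ (φ n) X v‖
          ≤ ∫ X in A, C * ‖v‖ * ‖fderiv ℝ (φ n) X‖ :=
            norm_integral_le_of_norm_le ((hφi n).const_mul _).integrableOn
              (Eventually.of_forall (hterm n))
        _ ≤ ∫ X, C * ‖v‖ * ‖fderiv ℝ (φ n) X‖ :=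
            setIntegral_le_integral ((hφi n).const_mul _)
              (Eventually.of_forall fun X => by positivity)
        _ ≤ _ := by
            rw [integral_const_mul]
            gcongr
            exact hφv n
    · simpa using tendsto_one_div_add_atTop_nhds_zero_nat.const_mul (C * ‖v‖)
  have hR : Tendsto (fun n => ∫ y in frontier A, φ n y * f y * ⟪v, outerNormal A y⟫ ∂μHE[2]) atTop
      (𝓝 (∫ y in frontier A, f y * ⟪v, outerNormal A y⟫ ∂μHE[2])) := by
    refine tendsto_integral_of_dominated_convergence (fun y => ‖f y * ⟪v, outerNormal A y⟫‖)
      (fun n => (hA.integrableOn_mul_inner_outerNormal hb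
        ((hφ1' n).continuous.mul hf.continuous) v).aestronglyMeasurable)
      (hA.integrableOn_mul_inner_outerNormal hb hf.continuous v).norm
      (fun n => Eventually.of_forall fun y => ?_) ?_
    · rw [mul_assoc, norm_mul]
      exact mul_le_of_le_one_left (norm_nonneg _) (hφb n y)
    · filter_upwards [ae_restrict_of_ae (compl_mem_ae_iff.2 hk0)] with y hy
      refine tendsto_const_nhds.congr' ?_
      filter_upwards [hlim y hy] with n hn
      rw [hn, one_mul]
  have hL := hL1.add hL2
  rw [add_zero] at hL
  refine tendsto_nhds_unique (hL.congr fun n => ?_) hR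
  rw [← hsplit, hdiv]

/-- The **divergence theorem** on bounded piecewise Lipschitz regions. -/
theorem HasPiecewiseLipschitzBoundary.setIntegral_fderiv {A : Set E3}
    (hA : HasPiecewiseLipschitzBoundary A) (hb : Bornology.IsBounded A)
    {f : E3 → ℝ} (hf : ContDiff ℝ 1 f) (v : E3) :
    ∫ X in A, fderiv ℝ f X v = ∫ y in frontier A, f y * ⟪v, outerNormal A y⟫ ∂μHE[2] := by
  obtain ⟨R, hR, hAR⟩ := hb.closure.subset_ball_lt 0 0
  set β : ContDiffBump (0 : E3) := ⟨R, R + 1, hR, by linarith⟩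
  have hβ : ∀ x ∈ closure A, ∀ᶠ y in 𝓝 x, β y * f y = f y := by
    intro x hx
    filter_upwards [Metric.isOpen_ball.mem_nhds (hAR hx)] with y hy
    rw [β.one_of_mem_closedBall (Metric.ball_subset_closedBall hy), one_mul]
  have h := hA.setIntegral_fderiv_of_hasCompactSupport hb
    ((β.contDiff (n := 1)).mul hf) β.hasCompactSupport.mul_right v
  have h1 : ∫ X in A, fderiv ℝ (fun x => β x * f x) X v = ∫ X in A, fderiv ℝ f X v := by
    refine setIntegral_congr_ae₀ hA.nullMeasurableSet (Eventually.of_forall fun X hX => ?_)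
    rw [EventuallyEq.fderiv_eq (hβ X (subset_closure hX))]
  have h2 : ∫ y in frontier A, β y * f y * ⟪v, outerNormal A y⟫ ∂μHE[2] =
      ∫ y in frontier A, f y * ⟪v, outerNormal A y⟫ ∂μHE[2] := by
    refine setIntegral_congr_fun isClosed_frontier.measurableSet fun y hy => ?_
    rw [(hβ y (frontier_subset_closure hy)).self_of_nhds]
  rw [← h1, ← h2]
  exact h

end Divergence

/-! ### The flux field of a dipole -/

section Dipole

theorem app_mul (A B : Mat3) (x : E3) : app (A * B) x = app A (app B x) := by
  simp only [app, map_mul]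
  rfl

theorem inner_app_comm {A : Mat3} (hA : A.IsHermitian) (x y : E3) : ⟪app A x, y⟫ = ⟪x, app A y⟫ := by
  have h : ContinuousLinearMap.adjoint (Matrix.toEuclideanCLM (n := Fin 3) (𝕜 := ℝ) A) =
      Matrix.toEuclideanCLM (n := Fin 3) (𝕜 := ℝ) A := by
    rw [← ContinuousLinearMap.star_eq_adjoint, ← map_star, Matrix.star_eq_conjTranspose, hA.eq]
  unfold app
  conv_lhs => rw [← h]
  exact ContinuousLinearMap.adjoint_inner_left _ _ _

theorem inner_app_pos {A : Mat3} (hA : A.PosDef) {x : E3} (hx : x ≠ 0) : 0 < ⟪x, app A x⟫ := by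
  have hx' : x.ofLp ≠ 0 := fun h => hx (by ext i; simp [h])
  have := hA.dotProduct_mulVec_pos hx'
  rw [EuclideanSpace.inner_eq_star_dotProduct, dotProduct_comm]
  simpa [app] using this

/-- The norm belonging to the quadratic form of `B`. -/
noncomputable def quadNorm (B : Mat3) (z : E3) : ℝ := √⟪z, app B z⟫

/-- The flux field of a dipole with moment `M` at the origin, up to a constant factor. -/
noncomputable def dipoleField (B : Mat3) (M z : E3) : E3 :=
  (quadNorm B z ^ 3)⁻¹ • M - (3 * ⟪M, app B z⟫ * (quadNorm B z ^ 5)⁻¹) • z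

variable {B : Mat3} {M z : E3}

theorem dipoleField_neg : dipoleField B M (-z) = dipoleField B M z := by
  have h : app B (-z) = -app B z := by simp [app]
  simp [dipoleField, quadNorm, h]

theorem quadNorm_pos (hB : B.PosDef) (hz : z ≠ 0) : 0 < quadNorm B z :=
  Real.sqrt_pos.2 (inner_app_pos hB hz)

theorem quadNorm_sq (hB : B.PosDef) (hz : z ≠ 0) : quadNorm B z ^ 2 = ⟪z, app B z⟫ :=
  Real.sq_sqrt (inner_app_pos hB hz).le

theorem contDiff_app (A : Mat3) : ContDiff ℝ ∞ (app A) :=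
  (Matrix.toEuclideanCLM (n := Fin 3) (𝕜 := ℝ) A).contDiff

theorem hasFDerivAt_app (A : Mat3) (z : E3) :
    HasFDerivAt (app A) (Matrix.toEuclideanCLM (n := Fin 3) (𝕜 := ℝ) A) z :=
  (Matrix.toEuclideanCLM (n := Fin 3) (𝕜 := ℝ) A).hasFDerivAt

/-- Differentiating `r² = ⟨z, Bz⟩` with `B` symmetric gives `r ∇r = Bz`; the rest is the chain rule.
-/
theorem hasFDerivAt_quadNorm_pow_inv (hB : B.PosDef) (hz : z ≠ 0) (n : ℕ) :
    HasFDerivAt (fun z => (quadNorm B z ^ n)⁻¹)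
      ((-(n : ℝ) * (quadNorm B z ^ (n + 2))⁻¹) • innerSL ℝ (app B z)) z := by
  have hpos := quadNorm_pos hB hz
  have h1 : HasFDerivAt (fun z => ⟪z, app B z⟫) ((2 : ℝ) • innerSL ℝ (app B z)) z := by
    refine ((hasFDerivAt_id z).inner ℝ (hasFDerivAt_app B z)).congr_fderiv ?_
    ext h
    have h2 := inner_app_comm hB.isHermitian z h
    simp only [ContinuousLinearMap.comp_apply, ContinuousLinearMap.prod_apply,
      fderivInnerCLM_apply, smul_apply, innerSL_apply_apply, id, smul_eq_mul,
      ContinuousLinearMap.id_apply]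
    change ⟪z, app B h⟫ + ⟪h, app B z⟫ = _
    rw [h2, real_inner_comm (app B z) h, h2]
    ring
  have h2 := (h1.sqrt (inner_app_pos hB hz).ne')
  have h3 := (hasDerivAt_inv (pow_ne_zero n hpos.ne')).comp_hasFDerivAt z (h2.pow n)
  refine h3.congr_fderiv ?_
  change -((quadNorm B z ^ n) ^ 2)⁻¹ • (n • quadNorm B z ^ (n - 1)) •
    ((1 / (2 * quadNorm B z)) • (2 : ℝ) • innerSL ℝ (app B z)) = _
  simp only [smul_smul, nsmul_eq_mul]
  congr 1
  rcases n with - | n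
  · simp
  · rw [Nat.add_sub_cancel]
    field_simp
    ring

theorem contDiffAt_dipoleField (hB : B.PosDef) (hz : z ≠ 0) : ContDiffAt ℝ ∞ (dipoleField B M) z := by
  have happ : ContDiffAt ℝ ∞ (app B) z := (contDiff_app B).contDiffAt
  have hq : ContDiffAt ℝ ∞ (quadNorm B) z :=
    (contDiffAt_id.inner ℝ happ).sqrt (inner_app_pos hB hz).ne'
  have hpos := quadNorm_pos hB hz
  exact (((hq.pow 3).inv (pow_ne_zero _ hpos.ne')).smul contDiffAt_const).sub
    (((contDiffAt_const.mul (contDiffAt_const.inner ℝ happ)).mul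
      ((hq.pow 5).inv (pow_ne_zero _ hpos.ne'))).smul contDiffAt_id)

/-- The flux field of a dipole is divergence free. -/
theorem sum_fderiv_dipoleField (hB : B.PosDef) (hz : z ≠ 0) (e : OrthonormalBasis (Fin 3) ℝ E3) :
    ∑ j, ⟪e j, fderiv ℝ (dipoleField B M) z (e j)⟫ = 0 := by
  have hpos := quadNorm_pos hB hz
  have h3 := hasFDerivAt_quadNorm_pow_inv hB hz 3
  have h5 := hasFDerivAt_quadNorm_pow_inv hB hz 5
  have hM : HasFDerivAt (fun z => 3 * ⟪M, app B z⟫) ((3 : ℝ) • innerSL ℝ (app B M)) z := by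
    have h0 : (fun z => 3 * ⟪M, app B z⟫) = fun z => ((3 : ℝ) • innerSL ℝ (app B M)) z := by
      funext z
      simp [inner_app_comm hB.isHermitian]
    rw [h0]
    exact ContinuousLinearMap.hasFDerivAt _
  have hD := (h3.smul_const M).sub ((hM.mul h5).smul (hasFDerivAt_id z))
  have hfd : ∀ h, fderiv ℝ (dipoleField B M) z h =
      (-3 * (quadNorm B z ^ 5)⁻¹ * ⟪app B z, h⟫) • M -
        ((3 * ⟪M, app B z⟫ * (quadNorm B z ^ 5)⁻¹) • h +
          (3 * ⟪M, app B z⟫ * (-5 * (quadNorm B z ^ 7)⁻¹ * ⟪app B z, h⟫) +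
            (quadNorm B z ^ 5)⁻¹ * (3 * ⟪app B M, h⟫)) • z) := by
    intro h
    rw [show fderiv ℝ (dipoleField B M) z = _ from hD.fderiv]
    simp
  have htr : ∀ a b : E3, ∑ j, ⟪a, e j⟫ * ⟪e j, b⟫ = ⟪a, b⟫ := fun a b => e.sum_inner_mul_inner a b
  have hq := quadNorm_sq hB hz
  have hMz : ⟪app B M, z⟫ = ⟪M, app B z⟫ := inner_app_comm hB.isHermitian M z
  have hzM : ⟪app B z, M⟫ = ⟪M, app B z⟫ := real_inner_comm _ _
  have hzz : ⟪app B z, z⟫ = quadNorm B z ^ 2 := by rw [hq, real_inner_comm]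
  have hterm : ∀ j, ⟪e j, fderiv ℝ (dipoleField B M) z (e j)⟫ =
      (-3 * (quadNorm B z ^ 5)⁻¹) * (⟪app B z, e j⟫ * ⟪e j, M⟫)
        - 3 * ⟪M, app B z⟫ * (quadNorm B z ^ 5)⁻¹
        + 15 * ⟪M, app B z⟫ * (quadNorm B z ^ 7)⁻¹ * (⟪app B z, e j⟫ * ⟪e j, z⟫)
        - 3 * (quadNorm B z ^ 5)⁻¹ * (⟪app B M, e j⟫ * ⟪e j, z⟫) := by
    intro j
    have hjj : ⟪e j, e j⟫ = 1 := by rw [real_inner_self_eq_norm_sq, e.norm_eq_one, one_pow]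
    rw [hfd]
    simp only [inner_sub_right, inner_add_right, inner_smul_right, hjj]
    ring
  simp only [hterm, Finset.sum_sub_distrib, Finset.sum_add_distrib, ← Finset.mul_sum, htr,
    Finset.sum_const, Finset.card_univ, Fintype.card_fin, hzM, hzz, hMz]
  -- In units of `⟨M, Bz⟩ r⁻⁵` the four terms are `-3 - 9 + 15 - 3 = 0`; the `9` is three times the
  -- trace of the identity, i.e. the dimension.
  have h7 : (quadNorm B z ^ 7)⁻¹ * quadNorm B z ^ 2 = (quadNorm B z ^ 5)⁻¹ := by field_simp
  rw [nsmul_eq_mul]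
  push_cast
  linear_combination 15 * ⟪M, app B z⟫ * h7

/-- The flux density of the dipole potential away from the source. -/
theorem app_gradient_dipolePotential {S : Mat3} (hS : S.PosDef) {x x₀ : E3} (hx : x ≠ x₀) :
    app S (∇ (dipolePotential S M x₀) x) =
      (1 / (4 * Real.pi * √S.det)) • dipoleField S⁻¹ M (x - x₀) := by
  have hB : (S⁻¹).PosDef := hS.inv
  have hz : x - x₀ ≠ 0 := sub_ne_zero.2 hx
  set c := 1 / (4 * Real.pi * √S.det)
  set z := x - x₀
  have h3 := hasFDerivAt_quadNorm_pow_inv hB hz 3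
  have hM : HasFDerivAt (fun z => ⟪M, app S⁻¹ z⟫) (innerSL ℝ (app S⁻¹ M)) z := by
    have h0 : (fun z => ⟪M, app S⁻¹ z⟫) = fun z => innerSL ℝ (app S⁻¹ M) z := by
      funext z
      simp [inner_app_comm hB.isHermitian]
    rw [h0]
    exact ContinuousLinearMap.hasFDerivAt _
  have hu := ((hM.mul h3).const_mul c)
  have hcomp := hu.comp x ((hasFDerivAt_id x).sub_const x₀)
  have hg : HasGradientAt (dipolePotential S M x₀)
      (c • ((quadNorm S⁻¹ z ^ 3)⁻¹ • app S⁻¹ M -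
        (3 * ⟪M, app S⁻¹ z⟫ * (quadNorm S⁻¹ z ^ 5)⁻¹) • app S⁻¹ z)) x := by
    rw [hasGradientAt_iff_hasFDerivAt]
    refine (hcomp.congr_fderiv ?_)
    ext h
    simp
    ring
  have hS1 : ∀ w, app S (app S⁻¹ w) = w := fun w => by
    rw [← app_mul, Matrix.mul_nonsing_inv _ (Matrix.isUnit_iff_isUnit_det _ |>.1 hS.isUnit)]
    simp [app]
  have hlin : ∀ (a b : ℝ) (v w : E3), app S (a • v - b • w) = a • app S v - b • app S w :=
    fun a b v w => by simp [app]
  have hlin' : ∀ (a : ℝ) (v : E3), app S (a • v) = a • app S v := fun a v => by simp [app]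
  rw [hg.gradient, hlin', hlin, hS1, hS1, dipoleField]

/-- The total flux of a dipole through a closed surface around it is zero. -/
theorem integral_inner_dipoleField_outerNormal (hB : B.PosDef) {P : Set E3} {x₀ : E3}
    (hx₀ : P ∈ 𝓝 x₀) (hb : Bornology.IsBounded P) (hP : HasPiecewiseLipschitzBoundary P) :
    ∫ y in frontier P, ⟪dipoleField B M (y - x₀), outerNormal P y⟫ ∂μHE[2] = 0 := by
  obtain ⟨δ, hδ, hδP⟩ := Metric.isOpen_iff.1 isOpen_interior x₀ (mem_interior_iff_mem_nhds.2 hx₀)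
  -- The factor `1 - β` removes the singularity without changing the field near the frontier, and
  -- `β` is symmetric about `x₀`.
  set β : ContDiffBump x₀ := ⟨δ / 4, δ / 2, by linarith, by linarith⟩
  have hβP : Metric.closedBall x₀ (δ / 2) ⊆ interior P :=
    (Metric.closedBall_subset_ball (by linarith)).trans hδP
  set G : E3 → E3 := fun x => (1 - β x) • dipoleField B M (x - x₀) with hG
  have hGd : ContDiff ℝ 1 G := by
    refine contDiff_iff_contDiffAt.2 fun x => ?_
    by_cases hx : x = x₀
    · have h0 : G =ᶠ[𝓝 x] fun _ => 0 := by
        rw [hx]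
        filter_upwards [β.eventuallyEq_one] with y hy
        simp [hG, hy]
      exact contDiffAt_const.congr_of_eventuallyEq h0
    · have h0 : ContDiffAt ℝ 1 (dipoleField B M) (x - x₀) :=
        (contDiffAt_dipoleField hB (sub_ne_zero.2 hx)).of_le (by exact_mod_cast le_top)
      have h1 : ContDiffAt ℝ 1 (fun x => dipoleField B M (x - x₀)) x :=
        h0.fun_comp x (by fun_prop)
      exact (contDiffAt_const.sub β.contDiffAt).smul h1
  have hGo : ∀ x ∉ Metric.closedBall x₀ (δ / 2), G =ᶠ[𝓝 x] fun x => dipoleField B M (x - x₀) := by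
    intro x hx
    filter_upwards [Metric.isClosed_closedBall.isOpen_compl.mem_nhds hx] with y hy
    have : β y = 0 := β.zero_of_le_dist (not_le.1 (fun h => hy (Metric.mem_closedBall.2 h))).le
    simp [hG, this]
  have hGsymm : ∀ x, G (x₀ + x₀ - x) = G x := by
    intro x
    have h1 : x₀ + x₀ - x = x₀ - (x - x₀) := by abel
    have h2 : x₀ - (x - x₀) - x₀ = -(x - x₀) := by abel
    simp only [hG]
    rw [h1, β.sub, h2, dipoleField_neg, add_sub_cancel]
  set e := EuclideanSpace.basisFun (Fin 3) ℝ
  have hfd : ∀ j, ContDiff ℝ 1 fun x => ⟪e j, G x⟫ := fun j => contDiff_const.inner ℝ hGd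
  set d : E3 → ℝ := fun x => ∑ j, fderiv ℝ (fun x => ⟪e j, G x⟫) x (e j) with hd
  have hd0 : ∀ x ∉ P, d x = 0 := by
    intro x hx
    have hxb : x ∉ Metric.closedBall x₀ (δ / 2) := fun h => hx (interior_subset (hβP h))
    have hxx : x - x₀ ≠ 0 := fun h => hxb (by
      rw [sub_eq_zero.1 h]; exact Metric.mem_closedBall_self (by linarith))
    rw [hd, ← sum_fderiv_dipoleField (M := M) hB hxx e]
    refine Finset.sum_congr rfl fun j _ => ?_
    have h1 : (fun x => ⟪e j, G x⟫) =ᶠ[𝓝 x] fun x => ⟪e j, dipoleField B M (x - x₀)⟫ := by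
      filter_upwards [hGo x hxb] with y hy
      rw [hy]
    have h2 := ((contDiffAt_dipoleField (M := M) hB hxx).differentiableAt (by simp)).hasFDerivAt
    have h3 := (h2.comp x ((hasFDerivAt_id x).sub_const x₀))
    have h4 := (innerSL ℝ (e j)).hasFDerivAt.comp x h3
    rw [h1.fderiv_eq]
    change fderiv ℝ ((innerSL ℝ (e j)) ∘ dipoleField B M ∘ fun x => id x - x₀) x (e j) = _
    rw [h4.fderiv]
    rfl
  have hodd : ∀ x, d (x₀ + x₀ - x) = -d x := by
    intro x
    simp only [hd, ← Finset.sum_neg_distrib]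
    refine Finset.sum_congr rfl fun j _ => ?_
    have h1 := ((hfd j).differentiable one_ne_zero x).hasFDerivAt
    have h2 : HasFDerivAt (fun y : E3 => x₀ + x₀ - y) (-ContinuousLinearMap.id ℝ E3)
        (x₀ + x₀ - x) := (hasFDerivAt_id _).const_sub _
    have h3 : HasFDerivAt (fun x => ⟪e j, G x⟫) (fderiv ℝ (fun x => ⟪e j, G x⟫) x)
        (x₀ + x₀ - (x₀ + x₀ - x)) := by rwa [sub_sub_cancel]
    have h4 := h3.comp (x₀ + x₀ - x) h2
    have h5 : (fun x => ⟪e j, G x⟫) ∘ (fun y : E3 => x₀ + x₀ - y) = fun x => ⟪e j, G x⟫ := by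
      funext y
      simp only [Function.comp_apply, hGsymm]
    rw [h5] at h4
    rw [h4.fderiv]
    simp
  -- Reflection at `x₀` preserves volume and changes the sign of `d`.
  have hdint : ∫ x, d x = 0 := by
    have h1 := integral_sub_left_eq_self d volume (x₀ + x₀)
    simp only [hodd, integral_neg] at h1
    linarith
  have hdP : ∫ x in P, d x = 0 := by
    rw [setIntegral_eq_integral_of_forall_compl_eq_zero hd0, hdint]
  have hsupp : ∀ j, Continuous fun x => fderiv ℝ (fun x => ⟪e j, G x⟫) x (e j) := fun j =>
    ((hfd j).continuous_fderiv one_ne_zero).clm_apply continuous_const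
  have hPvol : IsCompact (closure P) :=
    Metric.isCompact_of_isClosed_isBounded isClosed_closure hb.closure
  rw [hd, integral_finsetSum _ fun j _ =>
    ((hsupp j).continuousOn.integrableOn_compact hPvol).mono_set subset_closure] at hdP
  simp only [hP.setIntegral_fderiv hb (hfd _)] at hdP
  rw [← integral_finsetSum _ fun j _ =>
    hP.integrableOn_mul_inner_outerNormal hb (hfd j).continuous (e j)] at hdP
  rw [← hdP]
  refine setIntegral_congr_fun isClosed_frontier.measurableSet fun y hy => ?_
  have hyb : y ∉ Metric.closedBall x₀ (δ / 2) := fun h => hy.2 (hβP h)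
  have hy2 : dipoleField B M (y - x₀) = G y := (hGo y hyb).self_of_nhds.symm
  rw [hy2, ← e.sum_inner_mul_inner (G y)]
  exact Finset.sum_congr rfl fun j _ => by rw [real_inner_comm]

end Dipole

/-! ### Constant functions: weak gradients and traces -/

theorem integral_gradient_eq_zero {φ : E3 → ℝ} (hφ : ContDiff ℝ 1 φ) (hc : HasCompactSupport φ) :
    ∫ x, ∇ φ x = 0 := by
  have hi : Integrable (∇ φ) := by
    refine Continuous.integrable_of_hasCompactSupport ?_ ?_
    · exact (InnerProductSpace.toDual ℝ E3).symm.continuous.comp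
        (hφ.continuous_fderiv one_ne_zero)
    · exact (hc.fderiv ℝ).comp_left (map_zero (InnerProductSpace.toDual ℝ E3).symm)
  refine ext_inner_left ℝ fun w => ?_
  rw [← integral_inner hi, inner_zero_right, ← integral_fderiv_eq_zero hφ hc w]
  refine integral_congr_ae (Eventually.of_forall fun x => ?_)
  dsimp only
  rw [real_inner_comm, gradient, InnerProductSpace.toDual_symm_apply]

theorem gradient_eq_zero_of_notMem_tsupport {φ : E3 → ℝ} {x : E3} (hx : x ∉ tsupport φ) :
    ∇ φ x = 0 := by
  rw [gradient, fderiv_of_notMem_tsupport ℝ hx, map_zero]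

variable {Ω : Set E3} {v : E3 → ℝ} {c : ℝ}

theorem hasWeakGradient_zero_of_ae_eq_const (hΩb : Bornology.IsBounded Ω)
    (hv : v =ᵐ[volume.restrict Ω] fun _ => c) : HasWeakGradient Ω v 0 := by
  have hi : IntegrableOn v Ω :=
    (integrableOn_const (C := c) hΩb.measure_lt_top.ne).congr hv.symm
  refine ⟨hi.locallyIntegrableOn, integrableOn_zero.locallyIntegrableOn, fun φ hφ hc hφΩ => ?_⟩
  have h1 : ∫ x in Ω, v x • ∇ φ x = ∫ x in Ω, c • ∇ φ x := by
    refine integral_congr_ae ?_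
    filter_upwards [hv] with x hx
    rw [hx]
  rw [h1, integral_smul, setIntegral_eq_integral_of_forall_compl_eq_zero fun x hx =>
    gradient_eq_zero_of_notMem_tsupport fun h => hx (hφΩ h),
    integral_gradient_eq_zero (hφ.of_le (by exact_mod_cast le_top)) hc]
  simp

/-- `weakGradient` is an arbitrary choice, so uniqueness is needed: the chosen field, like zero,
integrates to zero against every test function, and the fundamental lemma of the calculus of
variations applies. -/
theorem weakGradient_ae_eq_zero (hΩ : IsOpen Ω) (hΩb : Bornology.IsBounded Ω)
    (hv : v =ᵐ[volume.restrict Ω] fun _ => c) :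
    ∀ᵐ x ∂volume.restrict Ω, weakGradient Ω v x = 0 := by
  have h0 := hasWeakGradient_zero_of_ae_eq_const hΩb hv
  have hex : ∃ g, HasWeakGradient Ω v g := ⟨0, h0⟩
  rw [weakGradient, dif_pos hex, ae_restrict_iff' hΩ.measurableSet]
  obtain ⟨-, hloc, hg⟩ := hex.choose_spec
  refine hΩ.ae_eq_zero_of_integral_contDiff_smul_eq_zero hloc fun φ hφ hc hφΩ => ?_
  have h1 := hg φ hφ hc hφΩ
  rw [h0.2.2 φ hφ hc hφΩ] at h1
  have h2 : ∫ x in Ω, φ x • hex.choose x = 0 := by simpa using h1.symm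
  rw [← setIntegral_eq_integral_of_forall_compl_eq_zero (s := Ω), h2]
  intro x hx
  rw [image_eq_zero_of_notMem_tsupport fun h => hx (hφΩ h), zero_smul]

theorem memH1_const (hΩb : Bornology.IsBounded Ω) (c : ℝ) : MemH1 Ω fun _ => c := by
  have : IsFiniteMeasure (volume.restrict Ω) :=
    ⟨by rw [Measure.restrict_apply_univ]; exact hΩb.measure_lt_top⟩
  exact ⟨memLp_const c, 0, hasWeakGradient_zero_of_ae_eq_const hΩb (ae_eq_refl _), MemLp.zero⟩

/-- The ball contains a nonempty open piece of the region strictly below the graph. This is needed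
for traces, since a mean over a null set would be zero by default. -/
theorem IsLipschitzBoundaryPoint.volume_ball_inter_ne_zero {A : Set E3} {p : E3}
    (hp : IsLipschitzBoundaryPoint A p) (hpA : p ∈ frontier A) {r : ℝ} (hr : 0 < r) :
    volume (Metric.ball p r ∩ A) ≠ 0 := by
  obtain ⟨T, K, g, hg, hA⟩ := hp
  obtain ⟨U, hUA, hU, hpU⟩ := eventually_nhds_iff.1 hA
  have hfst := continuous_fst_apply T
  have hsnd := continuous_snd_apply T
  set V : Set E3 := Metric.ball p r ∩ (U ∩ {X | (T X).snd < g (T X).fst})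
  have hVo : IsOpen V := Metric.isOpen_ball.inter
    (hU.inter (isOpen_lt hsnd (hg.continuous.comp hfst)))
  have hVA : V ⊆ Metric.ball p r ∩ A := fun X hX => ⟨hX.1, (hUA X hX.2.1).1 hX.2.2⟩
  have hgraph : (T p).snd = g (T p).fst :=
    mem_range_graphChart_iff.1
      ((frontier_inter_eq_graph_inter hg.continuous hU hUA).subset ⟨hpA, hpU⟩).1
  have hlim : Tendsto (fun t : ℝ => p + (-t) • T.symm (WithLp.toLp 2 (0, 1))) (𝓝[>] 0) (𝓝 p) := by
    have : Tendsto (fun t : ℝ => p + (-t) • T.symm (WithLp.toLp 2 (0, 1))) (𝓝 0)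
        (𝓝 (p + (-(0 : ℝ)) • T.symm (WithLp.toLp 2 (0, 1)))) :=
      Continuous.tendsto (by fun_prop) 0
    simpa using this.mono_left nhdsWithin_le_nhds
  obtain ⟨t, ⟨ht1, ht2⟩, ht0⟩ := ((hlim.eventually (inter_mem (Metric.ball_mem_nhds p hr)
    (hU.mem_nhds hpU))).and self_mem_nhdsWithin).exists
  have ht0' : (0 : ℝ) < t := ht0
  have hne : V.Nonempty := ⟨_, ht1, ht2, by
    change (T _).snd < g (T _).fst
    simp [hgraph, ht0']⟩
  exact ((hVo.measure_pos volume hne).trans_le (measure_mono hVA)).ne'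

theorem trace_eq_const {A : Set E3} {y : E3} (hvA : v =ᵐ[volume.restrict A] fun _ => c)
    (hy : ∀ r > 0, volume (Metric.ball y r ∩ A) ≠ 0) : trace A v y = c := by
  refine Tendsto.limUnder_eq (tendsto_const_nhds.congr' ?_)
  filter_upwards [self_mem_nhdsWithin] with r hr
  have h1 : v =ᵐ[volume.restrict (Metric.ball y r ∩ A)] fun _ => c :=
    ae_restrict_of_ae_restrict_of_subset inter_subset_right hvA
  have h2 : volume (Metric.ball y r ∩ A) ≠ ⊤ :=
    (measure_mono inter_subset_left |>.trans_lt measure_ball_lt_top).ne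
  rw [average_congr h1, setAverage_const (hy r hr) h2]

end LocalizedSubtraction

/-! ### The functional vanishes on constants. -/

theorem lemmaC1
    (Ω : Set LocalizedSubtraction.E3) (hΩ : IsOpen Ω) (hΩb : Bornology.IsBounded Ω)
    (σ : LocalizedSubtraction.E3 → LocalizedSubtraction.Mat3)
    (hσ : ∀ x ∈ Ω, (σ x).PosDef)
    (x₀ M : LocalizedSubtraction.E3)
    (S : LocalizedSubtraction.Mat3) (hS : ∀ᶠ x in 𝓝 x₀, σ x = S)
    (P R : Set LocalizedSubtraction.E3)
    (hPΩ : P ⊆ Ω) (hx₀ : P ∈ 𝓝 x₀)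
    (hP : LocalizedSubtraction.HasPiecewiseLipschitzBoundary P)
    (hR : R ⊆ Ω \ P) (hRm : MeasurableSet R)
    (hPR : frontier P ⊆ frontier Ω ∪ frontier R)
    (χ : LocalizedSubtraction.E3 → ℝ)
    (hχc : ContinuousOn χ Ω) (hχ : LocalizedSubtraction.MemH1 Ω χ)
    (hχ1 : ∀ x ∈ P, χ x = 1) (hχ0 : ∀ x ∈ Ω \ (P ∪ R), χ x = 0) :
    (∀ c : ℝ, LocalizedSubtraction.MemH1 Ω (fun _ => c)) ∧
    (∀ (c : ℝ) (v : LocalizedSubtraction.E3 → ℝ), v =ᵐ[volume.restrict Ω] (fun _ => c) →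
      LocalizedSubtraction.rhs Ω P R χ σ S M x₀ v = 0) ∧
    (IntegrableOn (LocalizedSubtraction.fluxDensity S M x₀ P) (frontier P) μHE[2] ∧
      ∫ y in frontier P, LocalizedSubtraction.fluxDensity S M x₀ P y ∂μHE[2] = 0) := by
  open LocalizedSubtraction in
  have hSpos : S.PosDef := by
    rw [← hS.self_of_nhds]
    exact hσ x₀ (hPΩ (mem_of_mem_nhds hx₀))
  have hPb : Bornology.IsBounded P := hΩb.subset hPΩ
  -- The source is interior to the patch, so the flux field is smooth near the frontier.
  have hne : ∀ y ∈ frontier P, y ≠ x₀ := fun y hy h =>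
    hy.2 (h ▸ mem_interior_iff_mem_nhds.2 hx₀)
  have hflux : ∀ y ∈ frontier P, fluxDensity S M x₀ P y =
      1 / (4 * Real.pi * √S.det) * ⟪dipoleField S⁻¹ M (y - x₀), outerNormal P y⟫ := fun y hy => by
    rw [fluxDensity, app_gradient_dipolePotential hSpos (hne y hy), inner_smul_left]
    rfl
  have hfluxInt : IntegrableOn (fluxDensity S M x₀ P) (frontier P) μHE[2] := by
    have hcont : ContinuousOn (fun y => dipoleField S⁻¹ M (y - x₀)) (frontier P) := fun y hy =>
      ((contDiffAt_dipoleField hSpos.inv (sub_ne_zero.2 (hne y hy))).continuousAt.comp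
        (f := fun y => y - x₀) (by fun_prop)).continuousWithinAt
    exact IntegrableOn.congr_fun ((hP.integrableOn_inner_outerNormal hPb hcont).const_mul _)
      (fun y hy => (hflux y hy).symm) isClosed_frontier.measurableSet
  have hfluxZero : ∫ y in frontier P, fluxDensity S M x₀ P y ∂μHE[2] = 0 := by
    rw [setIntegral_congr_fun isClosed_frontier.measurableSet hflux, integral_const_mul,
      integral_inner_dipoleField_outerNormal hSpos.inv hx₀ hPb hP, mul_zero]
  refine ⟨memH1_const hΩb, fun c v hv => ?_, hfluxInt, hfluxZero⟩
  have hgrad := weakGradient_ae_eq_zero hΩ hΩb hv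
  have hvol : ∀ (s : Set E3) (F : E3 → E3), s ⊆ Ω → ∫ x in s, ⟪F x, weakGradient Ω v x⟫ = 0 := by
    intro s F hs
    refine integral_eq_zero_of_ae ?_
    filter_upwards [ae_restrict_of_ae_restrict_of_subset hs hgrad] with x hx
    rw [hx, inner_zero_right]
    rfl
  obtain ⟨-, N, -, hN0, hN⟩ := id hP
  -- The trace is identified only at Lipschitz boundary points; the exceptional set `N` has area
  -- zero.
  have htr : ∫ y in frontier P, fluxDensity S M x₀ P y * trace P v y ∂μHE[2] =
      ∫ y in frontier P, fluxDensity S M x₀ P y * c ∂μHE[2] := by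
    refine integral_congr_ae ?_
    filter_upwards [ae_restrict_mem isClosed_frontier.measurableSet,
      ae_restrict_of_ae (compl_mem_ae_iff.2 hN0)] with y hy hyN
    rw [trace_eq_const (ae_restrict_of_ae_restrict_of_subset hPΩ hv) fun r hr =>
      (hN y ⟨hy, hyN⟩).volume_ball_inter_ne_zero hy hr]
  rw [rhs, hvol R _ (hR.trans sdiff_subset), hvol P _ hPΩ, htr, integral_mul_const, hfluxZero]
  simp
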